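/- Let $d,n\ge1$, $2<p\le\infty$ (with $1/\infty=0$), $\nu,\eta\in\mathbb R$, $\delta>0$. Let $\psi,\varphi_1,\dots,\varphi_n:\mathbb R^d\to\mathbb C$ be measurable functions such that $|\psi(ct)|=c^\eta|\psi(t)|$ and $|\varphi_j(ct)|=c^\nu|\varphi_j(t)|$ for all $c>0$, $t\ne0$, and such that $\psi(t)\ne0$ and $\sum_{j=1}^n|\varphi_j(t)|\ne0$ for almost all $t$. Put $s_2(t)=\sum_{j=1}^n|\varphi_j(t)|^2$ and $$\tilde\gamma=\frac{\nu-\eta}{\nu+d(1/2-1/p)},\qquad \tilde q=\frac1{\tilde\gamma(1/2-1/p)},$$ $$C_p(\nu,\eta)=\tilde\gamma^{-\tilde\gamma/p}\Bigl(\frac{1-\tilde\gamma}n\Bigr)^{-\frac{1-\tilde\gamma}2}\Bigl(\frac{B\bigl(\tilde q\tilde\gamma/p+1,\ \tilde q(1-\tilde\gamma)/2\bigr)}{2|\nu-\eta|}\Bigr)^{1/\tilde q},$$ where $B$ is the beta function. For $d\ge2$ and a function $f$ on $\mathbb R^d$ let $\tilde f(\omega)=|f(\theta(\omega))|$, where $\theta(\omega)=(\cos\omega_1,\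 \sin\omega_1\cos\omega_2,\ \dots,\ \sin\omega_1\cdots\sin\omega_{d-2}\cos\omega_{d-1},\ \sin\omega_1\cdots\sin\omega_{d-1})$ for $\omega\in\Pi^{d-1}=[0,\pi]^{d-2}\times[0,2\pi]$, and let $J(\omega)=\sin^{d-2}\omega_1\sin^{d-3}\omega_2\cdots\sin\omega_{d-2}$; for $d=1$ the integrals over $\Pi^{d-1}$ below mean the sum of the values at the two points $\theta=\pm1$. Assume that $\tilde\gamma\in(0,1)$, that $$I=\int_{\Pi^{d-1}}\frac{\tilde\psi^{\tilde q}(\omega)}{\tilde s_2^{\,\tilde q(1-\tilde\gamma)/2}(\omega)}J(\omega)\,d\omega<\infty,$$ and that $I_1'=\dots=I_n'$, where $$I_j'=\int_{\Pi^{d-1}}\frac{\tilde\psi^{\tilde q}(\omega)\,\tilde\varphi_j^2(\omega)}{\tilde s_2^{\,\tilde q(1-\tilde\gamma)/2+1}(\omega)}J(\omega)\,d\omega .$$ Let $F$ be the Fourier transform on the space $S'$ of tempered distributions on $\mathbb R^d$, with the normalization $Fx(\xi)=\int x(t)e^{-i\langle\xi,t\rangle}dt$. Let $X_p=\{x\in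 S': Fx\in L_p(\mathbb R^d),\ \varphi_jFx\in L_2(\mathbb R^d),\ j=1,\dots,n\}$, $D_jx=F^{-1}(\varphi_jFx)$, $\Lambda x=F^{-1}(\psi Fx)$ and $W=\{x\in X_p:\|D_jx\|_{L_2(\mathbb R^d)}\le1,\ j=1,\dots,n\}$. The error of a method $m$, that is, of an arbitrary map $m:L_p(\mathbb R^d)\to L_2(\mathbb R^d)$, is $$e(m)=\sup\bigl\{\|\Lambda x-m(y)\|_{L_2(\mathbb R^d)}:\ x\in W,\ y\in L_p(\mathbb R^d),\ \|Fx-y\|_{L_p(\mathbb R^d)}\le\delta\bigr\},$$ $E=\inf_m e(m)$, and a method $m$ is called optimal if $e(m)=E$. Then $\psi Fx\in L_2(\mathbb R^d)$ for every $x\in X_p$, so that $\Lambda$ maps $X_p$ to $L_2(\mathbb R^d)$, and $$E=\frac1{(2\pi)^{d\tilde\gamma/2}}\,C_p(\nu,\eta)\,I^{1/\tilde q}\,\delta^{\tilde\gamma}.$$ The map $$\hat m(y)=F^{-1}\Bigl(\Bigl(1-\beta\frac{s_2}{|\psi|^2}\Bigr)_+\psi\, y\Bigr),\qquad \beta=\frac{1-\tilde\gamma}{n(2\pi)^{d\tilde\gamma}}\,C_p^2(\nu,\eta)\,\bigl(\delta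 I^{1/2-1/p}\bigr)^{2\tilde\gamma},$$ where $a_+=\max\{a,0\}$, is well defined from $L_p(\mathbb R^d)$ to $L_2(\mathbb R^d)$ and is an optimal method. Moreover, for all $x\in X_p$ $$\|\Lambda x\|_{L_2(\mathbb R^d)}\le\frac1{(2\pi)^{d\tilde\gamma/2}}\,C_p(\nu,\eta)\,I^{1/\tilde q}\,\|Fx\|_{L_p(\mathbb R^d)}^{\tilde\gamma}\Bigl(\max_{1\le j\le n}\|D_jx\|_{L_2(\mathbb R^d)}\Bigr)^{1-\tilde\gamma},$$ and this inequality is sharp: the constant on the right-hand side cannot be replaced by a smaller one. -/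

import Mathlib

open MeasureTheory Set
open scoped ENNReal SchwartzMap FourierTransform

noncomputable section

namespace NoisyFourier

/-- The Euclidean space `ℝ^d`. -/
abbrev Rd (d : ℕ) : Type := EuclideanSpace ℝ (Fin d)

/-! ### Fourier transform of tempered distributions, normalised by `e^{-i⟨ξ,t⟩}` -/

/-- The dilation `t ↦ c t` of `ℝ^d`, `c ≠ 0`. -/
def dilation (d : ℕ) (c : ℝ) (hc : c ≠ 0) : Rd d ≃L[ℝ] Rd d :=
  ContinuousLinearEquiv.smulLeft (Units.mk0 c hc)

theorem dilation_apply (d : ℕ) (c : ℝ) (hc : c ≠ 0) (t : Rd d) : dilation d c hc t = c • t := rfl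

theorem two_pi_ne_zero : (2 * Real.pi : ℝ) ≠ 0 := by positivity

/-- The Fourier transform of Schwartz functions, `ξ ↦ ∫ f(t) e^{-i⟨ξ,t⟩} dt`
(Mathlib's `𝓕` has the kernel `e^{-2πi⟨ξ,t⟩}`). -/
def schwartzFourier (d : ℕ) : 𝓢(Rd d, ℂ) →L[ℂ] 𝓢(Rd d, ℂ) :=
  (SchwartzMap.compCLMOfContinuousLinearEquiv ℂ
    (dilation d (2 * Real.pi)⁻¹ (inv_ne_zero two_pi_ne_zero))) ∘L
    (FourierTransform.fourierCLM ℂ 𝓢(Rd d, ℂ))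

/-- The inverse Fourier transform of Schwartz functions,
`t ↦ (2π)^{-d} ∫ f(ξ) e^{i⟨ξ,t⟩} dξ`. -/
def schwartzFourierInv (d : ℕ) : 𝓢(Rd d, ℂ) →L[ℂ] 𝓢(Rd d, ℂ) :=
  (FourierTransform.fourierInvCLM ℂ 𝓢(Rd d, ℂ)) ∘L
    (SchwartzMap.compCLMOfContinuousLinearEquiv ℂ (dilation d (2 * Real.pi) two_pi_ne_zero))

/-- The Fourier transform `F : S' → S'`. -/
def tempFourier (d : ℕ) : 𝓢'(Rd d, ℂ) →L[ℂ] 𝓢'(Rd d, ℂ) :=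
  PointwiseConvergenceCLM.precomp ℂ (schwartzFourier d)

/-- The inverse Fourier transform `F⁻¹ : S' → S'`. -/
def tempFourierInv (d : ℕ) : 𝓢'(Rd d, ℂ) →L[ℂ] 𝓢'(Rd d, ℂ) :=
  PointwiseConvergenceCLM.precomp ℂ (schwartzFourierInv d)

/-- The `L_q`-norm of a tempered distribution: the norm of the `L_q`-function that represents it
(which is unique if it exists), and `∞` if there is none. -/
def distNorm {d : ℕ} (q : ℝ≥0∞) [Fact (1 ≤ q)] (T : 𝓢'(Rd d, ℂ)) : ℝ≥0∞ :=
  ⨅ (f : Lp ℂ q (volume : Measure (Rd d))) (_ : (f : 𝓢'(Rd d, ℂ)) = T), ‖f‖ₑ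

open Classical in
/-- The function `Fx ∈ L_p` that represents the Fourier transform of `x`
(used only if there is one). -/
def fourierFun {d : ℕ} (p : ℝ≥0∞) [Fact (1 ≤ p)] (x : 𝓢'(Rd d, ℂ)) : Rd d → ℂ :=
  if h : ∃ g : Lp ℂ p (volume : Measure (Rd d)), (g : 𝓢'(Rd d, ℂ)) = tempFourier d x
  then ⇑(Classical.choose h) else 0

open Classical in
/-- A function of class `L_2` as a tempered distribution (used only for such functions; `0` otherwise). -/
def l2Dist {d : ℕ} (f : Rd d → ℂ) : 𝓢'(Rd d, ℂ) :=
  if h : MemLp f 2 (volume : Measure (Rd d)) then ((h.toLp f : Lp ℂ 2 volume) : 𝓢'(Rd d, ℂ)) else 0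

/-- The operator `x ↦ F⁻¹(m · Fx)`, for `Fx ∈ L_p` and `m · Fx ∈ L_2`. -/
def multiplierOp {d : ℕ} (p : ℝ≥0∞) [Fact (1 ≤ p)] (m : Rd d → ℂ) (x : 𝓢'(Rd d, ℂ)) :
    𝓢'(Rd d, ℂ) :=
  tempFourierInv d (l2Dist fun ξ => m ξ * fourierFun p x ξ)

/-! ### The recovery problem -/

/-- The space `X_p` of all `x ∈ S'` with `Fx ∈ L_p` and `φ_j Fx ∈ L_2` for all `j`. -/
def spaceX {d n : ℕ} (p : ℝ≥0∞) [Fact (1 ≤ p)] (φ : Fin n → Rd d → ℂ) : Set 𝓢'(Rd d, ℂ) :=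
  {x | (∃ g : Lp ℂ p (volume : Measure (Rd d)), (g : 𝓢'(Rd d, ℂ)) = tempFourier d x) ∧
    ∀ j, MemLp (fun ξ => φ j ξ * fourierFun p x ξ) 2 (volume : Measure (Rd d))}

/-- The class `W_p` of all `x ∈ X_p` with `‖D_j x‖_{L_2} ≤ 1` for all `j`. -/
def classW {d n : ℕ} (p : ℝ≥0∞) [Fact (1 ≤ p)] (φ : Fin n → Rd d → ℂ) : Set 𝓢'(Rd d, ℂ) :=
  {x | x ∈ spaceX p φ ∧ ∀ j, distNorm 2 (multiplierOp p (φ j) x) ≤ 1}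

/-- Recovery methods: all maps `L_p → L_2`. -/
abbrev Method (d : ℕ) (p : ℝ≥0∞) : Type :=
  Lp ℂ p (volume : Measure (Rd d)) → Lp ℂ 2 (volume : Measure (Rd d))

/-- The error of the method `m`: the supremum of `‖Λx - m(y)‖_{L_2}` over all `x ∈ W_p` and
`y ∈ L_p` with `‖Fx - y‖_{L_p} ≤ δ`, where `Λx = F⁻¹(ψ Fx)`. -/
def methodError {d n : ℕ} (p : ℝ≥0∞) [Fact (1 ≤ p)] (ψ : Rd d → ℂ) (φ : Fin n → Rd d → ℂ)
    (δ : ℝ) (m : Method d p) : ℝ≥0∞ :=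
  ⨆ (x : 𝓢'(Rd d, ℂ)) (_ : x ∈ classW p φ) (y : Lp ℂ p (volume : Measure (Rd d)))
    (_ : distNorm p (tempFourier d x - (y : 𝓢'(Rd d, ℂ))) ≤ ENNReal.ofReal δ),
    distNorm 2 (multiplierOp p ψ x - (m y : 𝓢'(Rd d, ℂ)))

/-- The error of optimal recovery. -/
def optimalError {d n : ℕ} (p : ℝ≥0∞) [Fact (1 ≤ p)] (ψ : Rd d → ℂ) (φ : Fin n → Rd d → ℂ)
    (δ : ℝ) : ℝ≥0∞ :=
  ⨅ m : Method d p, methodError p ψ φ δ m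

/-! ### Polar coordinates -/

/-- The point of the unit sphere with the angles `ω_1, …, ω_{d-1}`:
`(cos ω_1, sin ω_1 cos ω_2, …, sin ω_1 ⋯ sin ω_{d-2} cos ω_{d-1}, sin ω_1 ⋯ sin ω_{d-1})`. -/
def polarPoint (d : ℕ) (ω : Fin (d - 1) → ℝ) : Rd d :=
  WithLp.toLp 2 fun k : Fin d =>
    (∏ i : Fin (d - 1) with i.val < k.val, Real.sin (ω i)) *
      (if h : k.val < d - 1 then Real.cos (ω ⟨k.val, h⟩) else 1)

/-- `J(ω) = sin^{d-2} ω_1 sin^{d-3} ω_2 ⋯ sin ω_{d-2}`. -/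
def polarJacobian (d : ℕ) (ω : Fin (d - 1) → ℝ) : ℝ :=
  ∏ i : Fin (d - 1), Real.sin (ω i) ^ (d - 2 - i.val)

/-- `Π^{d-1} = [0,π]^{d-2} × [0,2π]`. -/
def angleBox (d : ℕ) : Set (Fin (d - 1) → ℝ) :=
  Set.univ.pi fun i => Icc 0 (if i.val + 2 < d then Real.pi else 2 * Real.pi)

/-- The integral of `f(ω) J(ω)` over `Π^{d-1}`, where `f(ω)` is `f` at the point of the unit sphere
with the angles `ω`; for `d = 1`, where there are no angles, the sum over the sphere `{1, -1}`. -/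
def angularIntegral (d : ℕ) (f : Rd d → ℝ≥0∞) : ℝ≥0∞ :=
  if d = 1 then f (polarPoint d 0) + f (-polarPoint d 0)
  else ∫⁻ ω in angleBox d, f (polarPoint d ω) * ENNReal.ofReal (polarJacobian d ω)

/-! ### The constants -/

/-- `|f|` is homogeneous of degree `κ` (away from the origin). -/
def IsAbsHomogeneous {d : ℕ} (f : Rd d → ℂ) (κ : ℝ) : Prop :=
  ∀ c : ℝ, 0 < c → ∀ t : Rd d, t ≠ 0 → ‖f (c • t)‖ = c ^ κ * ‖f t‖

/-- `1/p`, with `1/∞ = 0`. -/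
def recip (p : ℝ≥0∞) : ℝ := (p⁻¹).toReal

/-- `γ = (ν - η) / (ν + d(1/2 - 1/p))`. -/
def gam (d : ℕ) (p : ℝ≥0∞) (ν η : ℝ) : ℝ := (ν - η) / (ν + d * (1 / 2 - recip p))

/-- `q = 1 / (γ(1/2 - 1/p))`. -/
def qExp (d : ℕ) (p : ℝ≥0∞) (ν η : ℝ) : ℝ := 1 / (gam d p ν η * (1 / 2 - recip p))

/-- `s_2(t) = ∑ |φ_j(t)|²`. -/
def s2 {d n : ℕ} (φ : Fin n → Rd d → ℂ) (t : Rd d) : ℝ := ∑ j, ‖φ j t‖ ^ 2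

/-- The constant `C_p(ν,η)`. -/
def constC (d n : ℕ) (p : ℝ≥0∞) (ν η : ℝ) : ℝ :=
  gam d p ν η ^ (-(gam d p ν η * recip p)) *
    ((1 - gam d p ν η) / n) ^ (-((1 - gam d p ν η) / 2)) *
    (ProbabilityTheory.beta (qExp d p ν η * gam d p ν η * recip p + 1)
      (qExp d p ν η * (1 - gam d p ν η) / 2) / (2 * |ν - η|)) ^ (1 / qExp d p ν η)

/-- The integral `I`. -/
def intI {d n : ℕ} (p : ℝ≥0∞) (ν η : ℝ) (ψ : Rd d → ℂ) (φ : Fin n → Rd d → ℂ) : ℝ≥0∞ :=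
  angularIntegral d fun t => ENNReal.ofReal
    (‖ψ t‖ ^ qExp d p ν η / s2 φ t ^ (qExp d p ν η * (1 - gam d p ν η) / 2))

/-- The integrals `I'_j`. -/
def intI' {d n : ℕ} (p : ℝ≥0∞) (ν η : ℝ) (ψ : Rd d → ℂ) (φ : Fin n → Rd d → ℂ)
    (j : Fin n) : ℝ≥0∞ :=
  angularIntegral d fun t => ENNReal.ofReal
    (‖ψ t‖ ^ qExp d p ν η * ‖φ j t‖ ^ 2 /
      s2 φ t ^ (qExp d p ν η * (1 - gam d p ν η) / 2 + 1))

/-- The constant `(2π)^{-dγ/2} C_p(ν,η) I^{1/q}`. -/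
def sharpConst {d n : ℕ} (p : ℝ≥0∞) (ν η : ℝ) (ψ : Rd d → ℂ) (φ : Fin n → Rd d → ℂ) : ℝ :=
  1 / (2 * Real.pi) ^ (d * gam d p ν η / 2) * constC d n p ν η *
    (intI p ν η ψ φ).toReal ^ (1 / qExp d p ν η)

/-- `β = (1 - γ) / (n (2π)^{dγ}) · C_p(ν,η)² (δ I^{1/2 - 1/p})^{2γ}`. -/
def betaConst {d n : ℕ} (p : ℝ≥0∞) (ν η : ℝ) (ψ : Rd d → ℂ) (φ : Fin n → Rd d → ℂ)
    (δ : ℝ) : ℝ :=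
  (1 - gam d p ν η) / (n * (2 * Real.pi) ^ (d * gam d p ν η)) * constC d n p ν η ^ 2 *
    (δ * (intI p ν η ψ φ).toReal ^ (1 / 2 - recip p)) ^ (2 * gam d p ν η)

/-- The filter `(1 - β s_2/|ψ|²)_+ ψ`. -/
def optFilter {d n : ℕ} (p : ℝ≥0∞) (ν η : ℝ) (ψ : Rd d → ℂ) (φ : Fin n → Rd d → ℂ)
    (δ : ℝ) (t : Rd d) : ℂ :=
  ((max (1 - betaConst p ν η ψ φ δ * (s2 φ t / ‖ψ t‖ ^ 2)) 0 : ℝ) : ℂ) * ψ t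

end NoisyFourier

end

open NoisyFourier

open MeasureTheory Set
open scoped ENNReal SchwartzMap FourierTransform

noncomputable section

namespace NoisyFourier

/-! ### Integration in polar coordinates -/

theorem measurable_polarPoint (d : ℕ) : Measurable (polarPoint d) := by
  unfold polarPoint
  refine (PiLp.volume_preserving_toLp (Fin d)).measurable.comp ?_
  refine measurable_pi_lambda _ fun k => ?_
  refine Measurable.mul (Finset.measurable_prod _ fun i _ => by fun_prop) ?_
  split_ifs <;> fun_prop

theorem measurable_polarJacobian (d : ℕ) : Measurable (polarJacobian d) := by
  unfold polarJacobian
  fun_prop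

theorem measurableSet_angleBox (d : ℕ) : MeasurableSet (angleBox d) :=
  MeasurableSet.univ_pi fun _ => measurableSet_Icc

/-- The recursion behind the induction on the dimension. It starts from dimension 2, because there
the only angle runs over $[0,2\pi]$, whereas every angle added in front runs over $[0,\pi]$. -/
theorem polarPoint_cons (m : ℕ) (a : ℝ) (ω : Fin (m + 2 - 1) → ℝ) :
    polarPoint (m + 3) (Fin.cons (n := m + 1) (α := fun _ => ℝ) a ω) =
      WithLp.toLp 2 (Fin.cons (n := m + 2) (α := fun _ => ℝ) (Real.cos a)
        (fun k => Real.sin a * polarPoint (m + 2) ω k)) := by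
  ext k
  refine Fin.cases ?_ (fun k => ?_) k
  · simp [polarPoint]
  · simp only [polarPoint, Fin.cons_succ, PiLp.toLp_apply]
    have h1 : (∏ i : Fin (m + 2) with i.val < k.succ.val,
        Real.sin ((Fin.cons (n := m + 1) (α := fun _ => ℝ) a ω : Fin (m + 2) → ℝ) i)) =
        Real.sin a * ∏ i : Fin (m + 1) with i.val < k.val, Real.sin (ω i) := by
      rw [Finset.prod_filter, Fin.prod_univ_succ, Finset.prod_filter]
      simp
    have h2 : (if h : k.succ.val < m + 2 then Real.cos
          ((Fin.cons (n := m + 1) (α := fun _ => ℝ) a ω : Fin (m + 2) → ℝ) ⟨k.succ.val, h⟩) else 1) =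
        if h : k.val < m + 1 then Real.cos (ω ⟨k.val, h⟩) else 1 := by
      by_cases hk : k.val < m + 1
      · have : k.succ.val < m + 2 := by simp; omega
        rw [dif_pos hk, dif_pos this]
        rfl
      · have : ¬ k.succ.val < m + 2 := by simp; omega
        rw [dif_neg hk, dif_neg this]
    erw [h1, h2]
    rw [mul_assoc]
    rfl

theorem polarJacobian_cons (m : ℕ) (a : ℝ) (ω : Fin (m + 2 - 1) → ℝ) :
    polarJacobian (m + 3) (Fin.cons (n := m + 1) (α := fun _ => ℝ) a ω) =
      Real.sin a ^ (m + 1) * polarJacobian (m + 2) ω := by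
  unfold polarJacobian
  erw [Fin.prod_univ_succ]
  congr 1
  refine Finset.prod_congr rfl fun i _ => ?_
  simp only [Fin.cons_succ, Fin.val_succ]
  congr 1
  omega

theorem cons_mem_angleBox (m : ℕ) (a : ℝ) (ω : Fin (m + 2 - 1) → ℝ) :
    (Fin.cons (n := m + 1) (α := fun _ => ℝ) a ω : Fin (m + 3 - 1) → ℝ) ∈ angleBox (m + 3) ↔
      a ∈ Icc 0 Real.pi ∧ ω ∈ angleBox (m + 2) := by
  unfold angleBox
  rw [Set.mem_univ_pi, Set.mem_univ_pi]
  erw [Fin.forall_fin_succ]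
  simp only [Fin.cons_zero, Fin.cons_succ, Fin.val_succ]
  refine and_congr (by simp) (forall_congr' fun i => ?_)
  have : (i.val + 1 + 2 < m + 3) = (i.val + 2 < m + 2) := by
    apply propext; omega
  simp only [this]

/-- Used for the pair formed by the first coordinate and the radius of the remaining ones. That
radius is positive, so only angles with positive sine contribute, and the endpoints are null. -/
theorem lintegral_upperHalfPlane_polar (g : ℝ × ℝ → ℝ≥0∞) (hg : Measurable g) :
    ∫⁻ x, ∫⁻ y in Ioi 0, g (x, y) =
      ∫⁻ a in Icc 0 Real.pi, ∫⁻ ρ in Ioi 0,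
        g (ρ * Real.cos a, ρ * Real.sin a) * ENNReal.ofReal ρ := by
  have hS : MeasurableSet {z : ℝ × ℝ | 0 < z.2} := measurableSet_lt measurable_const measurable_snd
  have h1 : ∫⁻ x, ∫⁻ y in Ioi 0, g (x, y) = ∫⁻ z, {z : ℝ × ℝ | 0 < z.2}.indicator g z := by
    rw [Measure.volume_eq_prod, lintegral_prod _ (hg.indicator hS).aemeasurable]
    refine lintegral_congr fun x => ?_
    rw [← lintegral_indicator measurableSet_Ioi]
    rfl
  have hm : Measurable fun z : ℝ × ℝ =>
      g (z.2 * Real.cos z.1, z.2 * Real.sin z.1) * ENNReal.ofReal z.2 := by fun_prop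
  rw [h1, ← lintegral_comp_polarCoord_symm, polarCoord_target, Measure.volume_eq_prod,
    ← Measure.prod_restrict, lintegral_prod_symm']
  · rw [← lintegral_indicator measurableSet_Ioo, ← lintegral_indicator measurableSet_Icc]
    have hae : ∀ᵐ a : ℝ, a ≠ 0 ∧ a ≠ Real.pi := by
      have h0 : ∀ᵐ a : ℝ, a ≠ 0 := by simp [ae_iff]
      have h1 : ∀ᵐ a : ℝ, a ≠ Real.pi := by simp [ae_iff]
      exact h0.and h1
    refine lintegral_congr_ae ?_
    filter_upwards [hae] with a ⟨ha0, hapi⟩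
    by_cases ha : a ∈ Ioo 0 Real.pi
    · rw [indicator_of_mem (show a ∈ Ioo (-Real.pi) Real.pi from ⟨by linarith [ha.1, Real.pi_pos], ha.2⟩),
        indicator_of_mem (Ioo_subset_Icc_self ha)]
      refine setLIntegral_congr_fun measurableSet_Ioi fun ρ hρ => ?_
      have : 0 < ρ * Real.sin a := mul_pos hρ (Real.sin_pos_of_mem_Ioo ha)
      simp only [polarCoord_symm_apply, smul_eq_mul]
      rw [indicator_of_mem (by exact this), mul_comm]
    · rw [indicator_of_notMem (s := Icc 0 Real.pi)]
      · by_cases ha' : a ∈ Ioo (-Real.pi) Real.pi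
        · rw [indicator_of_mem ha']
          have hneg : a ≤ 0 := by
            by_contra h
            exact ha ⟨not_le.1 h, ha'.2⟩
          refine setLIntegral_eq_zero measurableSet_Ioi fun ρ hρ => ?_
          have : ¬ 0 < ρ * Real.sin a := by
            rw [not_lt]
            exact mul_nonpos_of_nonneg_of_nonpos (le_of_lt hρ)
              (Real.sin_nonpos_of_nonpos_of_neg_pi_le hneg ha'.1.le)
          simp only [polarCoord_symm_apply, smul_eq_mul]
          rw [indicator_of_notMem (by exact this)]
          simp
        · rw [indicator_of_notMem ha']
      · rintro ⟨h1, h2⟩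
        exact ha ⟨lt_of_le_of_ne h1 (Ne.symm ha0), lt_of_le_of_ne h2 hapi⟩
  · have : Measurable fun p : ℝ × ℝ => {z : ℝ × ℝ | 0 < z.2}.indicator g (polarCoord.symm p) :=
      (hg.indicator hS).comp continuous_polarCoord_symm.measurable
    simp only [smul_eq_mul]
    fun_prop

/-- The base case. Mathlib's angle lies in $(-\pi,\pi)$; periodicity moves the integral to
$[0,2\pi]$. -/
theorem lintegral_plane_polar (g : ℝ × ℝ → ℝ≥0∞) (hg : Measurable g) :
    ∫⁻ z, g z = ∫⁻ a in Icc 0 (2 * Real.pi), ∫⁻ ρ in Ioi 0,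
        g (ρ * Real.cos a, ρ * Real.sin a) * ENNReal.ofReal ρ := by
  have hm : Measurable fun z : ℝ × ℝ =>
      g (z.2 * Real.cos z.1, z.2 * Real.sin z.1) * ENNReal.ofReal z.2 := by fun_prop
  rw [← lintegral_comp_polarCoord_symm, polarCoord_target, Measure.volume_eq_prod,
    ← Measure.prod_restrict, lintegral_prod_symm']
  · set G : ℝ → ℝ≥0∞ := fun a => ∫⁻ ρ in Ioi 0,
        g (ρ * Real.cos a, ρ * Real.sin a) * ENNReal.ofReal ρ with hG
    have hper : Function.Periodic G (2 * Real.pi) := fun a => by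
      simp only [hG, Real.cos_add_two_pi, Real.sin_add_two_pi]
    have e1 : ∫⁻ a in Ioo (-Real.pi) Real.pi, ∫⁻ ρ in Ioi 0,
        ENNReal.ofReal (ρ, a).1 • g (polarCoord.symm (ρ, a)) =
        ∫⁻ a in Ioc (-Real.pi) (-Real.pi + 2 * Real.pi), G a := by
      rw [show -Real.pi + 2 * Real.pi = Real.pi by ring]
      rw [setLIntegral_congr Ioo_ae_eq_Ioc]
      simp only [hG, polarCoord_symm_apply, smul_eq_mul, mul_comm (ENNReal.ofReal _)]
    rw [e1]
    have e2 : ∫⁻ a in Icc 0 (2 * Real.pi), G a = ∫⁻ a in Ioc 0 (0 + 2 * Real.pi), G a := by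
      rw [zero_add]
      exact setLIntegral_congr Ioc_ae_eq_Icc.symm
    rw [e2]
    refine (isAddFundamentalDomain_Ioc Real.two_pi_pos (-Real.pi)).setLIntegral_eq
      (isAddFundamentalDomain_Ioc Real.two_pi_pos 0) G ?_
    rintro ⟨v, hv⟩ x
    obtain ⟨k, rfl⟩ := AddSubgroup.mem_zmultiples_iff.1 hv
    change G (k • (2 * Real.pi) + x) = G x
    rw [add_comm]
    exact (hper.zsmul k) x
  · have : Measurable fun p : ℝ × ℝ => g (polarCoord.symm p) :=
      hg.comp continuous_polarCoord_symm.measurable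
    simp only [smul_eq_mul]
    fun_prop

theorem lintegral_euclidean_succ (m : ℕ) (f : Rd (m + 1) → ℝ≥0∞) (hf : Measurable f) :
    ∫⁻ t, f t = ∫⁻ a : ℝ, ∫⁻ t : Rd m, f (WithLp.toLp 2 (Fin.cons (α := fun _ => ℝ) a t.ofLp)) := by
  have h1 := (PiLp.volume_preserving_toLp (Fin (m + 1))).lintegral_comp hf
  have h2 := (volume_preserving_piFinSuccAbove (fun _ : Fin (m + 1) => ℝ) 0).symm.lintegral_comp_emb
    (MeasurableEquiv.measurableEmbedding _) (fun u => f (WithLp.toLp 2 u))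
  rw [← h1, ← h2, Measure.volume_eq_prod, lintegral_prod]
  · refine lintegral_congr fun a => ?_
    rw [← (PiLp.volume_preserving_ofLp (Fin m)).lintegral_comp]
    · refine lintegral_congr fun t => ?_
      simp [MeasurableEquiv.piFinSuccAbove_symm_apply, Fin.consEquiv]
    · exact hf.comp ((PiLp.volume_preserving_toLp _).measurable.comp
        ((MeasurableEquiv.measurable _).comp measurable_prodMk_left))
  · exact (hf.comp ((PiLp.volume_preserving_toLp _).measurable.comp
        (MeasurableEquiv.measurable _))).aemeasurable

theorem lintegral_angleBox_succ (m : ℕ) (G : (Fin (m + 3 - 1) → ℝ) → ℝ≥0∞) (hG : Measurable G) :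
    ∫⁻ ω in angleBox (m + 3), G ω = ∫⁻ a in Icc 0 Real.pi, ∫⁻ ω in angleBox (m + 2),
      G (Fin.cons (n := m + 1) (α := fun _ => ℝ) a ω) := by
  have h2 := (volume_preserving_piFinSuccAbove (fun _ : Fin (m + 2) => ℝ) 0).symm.lintegral_comp_emb
    (MeasurableEquiv.measurableEmbedding _) ((angleBox (m + 3)).indicator G)
  rw [← lintegral_indicator (measurableSet_angleBox _)]
  refine h2.symm.trans ?_
  rw [Measure.volume_eq_prod, lintegral_prod]
  · rw [← lintegral_indicator measurableSet_Icc]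
    refine lintegral_congr fun a => ?_
    by_cases ha : a ∈ Icc 0 Real.pi
    · rw [indicator_of_mem ha, ← lintegral_indicator (measurableSet_angleBox _)]
      refine lintegral_congr fun ω => ?_
      simp only [MeasurableEquiv.piFinSuccAbove_symm_apply]
      erw [Fin.insertNthEquiv_zero]
      by_cases hω : ω ∈ angleBox (m + 2)
      · rw [indicator_of_mem hω]
        exact indicator_of_mem ((cons_mem_angleBox m a ω).2 ⟨ha, hω⟩) _
      · rw [indicator_of_notMem hω]
        exact indicator_of_notMem (fun h => hω ((cons_mem_angleBox m a ω).1 h).2) _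
    · rw [indicator_of_notMem ha]
      refine (lintegral_congr fun ω => ?_).trans lintegral_zero
      simp only [MeasurableEquiv.piFinSuccAbove_symm_apply]
      erw [Fin.insertNthEquiv_zero]
      exact indicator_of_notMem (fun h => ha ((cons_mem_angleBox m a ω).1 h).1) _
  · exact ((hG.indicator (measurableSet_angleBox _)).comp (MeasurableEquiv.measurable _)).aemeasurable

theorem aemeasurable_uncurry_lintegral {α β : Type*} [MeasurableSpace α] [MeasurableSpace β]
    (F : α → β → ℝ → ℝ≥0∞) (hF : Measurable fun z : (α × β) × ℝ => F z.1.1 z.1.2 z.2)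
    (μ : Measure (α × β)) (S : Set ℝ) :
    AEMeasurable (Function.uncurry fun a b => ∫⁻ ρ in S, F a b ρ) μ :=
  (Measurable.lintegral_prod_right' hF).aemeasurable

/-- Induction on the dimension: split off the first coordinate, use polar coordinates in the others,
then plane polar coordinates in the half-plane of (first coordinate, radius). -/
theorem lintegral_polar_of_measurable (m : ℕ) (f : Rd (m + 2) → ℝ≥0∞) (hf : Measurable f) :
    ∫⁻ t, f t = ∫⁻ ω in angleBox (m + 2), ∫⁻ ρ in Ioi (0 : ℝ),
      f (ρ • polarPoint (m + 2) ω) *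
        (ENNReal.ofReal (ρ ^ (m + 1)) * ENNReal.ofReal (polarJacobian (m + 2) ω)) := by
  induction m with
  | zero =>
    have h1 := (PiLp.volume_preserving_toLp (Fin 2)).lintegral_comp hf
    have h2 := (volume_preserving_finTwoArrow ℝ).symm.lintegral_comp_emb
      (MeasurableEquiv.measurableEmbedding _) (fun u => f (WithLp.toLp 2 u))
    have h3 := (volume_preserving_funUnique (Fin 1) ℝ).symm.lintegral_comp_emb
      (MeasurableEquiv.measurableEmbedding _)
      ((angleBox 2).indicator fun ω => ∫⁻ ρ in Ioi (0 : ℝ), f (ρ • polarPoint 2 ω) *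
        (ENNReal.ofReal (ρ ^ (0 + 1)) * ENNReal.ofReal (polarJacobian 2 ω)))
    rw [← h1, ← h2, lintegral_plane_polar, ← lintegral_indicator (measurableSet_angleBox _)]
    · refine Eq.trans ?_ h3
      rw [← lintegral_indicator measurableSet_Icc]
      refine lintegral_congr fun a => ?_
      have hmem : ((MeasurableEquiv.funUnique (Fin 1) ℝ).symm a ∈ angleBox 2) ↔
          a ∈ Icc 0 (2 * Real.pi) := by
        unfold angleBox
        rw [Set.mem_univ_pi]
        erw [Fin.forall_fin_one]
        simp
      by_cases ha : a ∈ Icc 0 (2 * Real.pi)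
      · rw [indicator_of_mem ha]
        erw [indicator_of_mem (hmem.2 ha)]
        refine setLIntegral_congr_fun measurableSet_Ioi fun ρ _ => ?_
        have hJ : polarJacobian 2 ((MeasurableEquiv.funUnique (Fin 1) ℝ).symm a) = 1 := by
          simp [polarJacobian]
        have hP : ρ • polarPoint 2 ((MeasurableEquiv.funUnique (Fin 1) ℝ).symm a) =
            WithLp.toLp 2 (MeasurableEquiv.finTwoArrow.symm (ρ * Real.cos a, ρ * Real.sin a)) := by
          ext k
          fin_cases k
          · simp [polarPoint]
          · simp [polarPoint]
        erw [hJ, hP]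
        simp
      · rw [indicator_of_notMem ha]
        erw [indicator_of_notMem (fun h => ha (hmem.1 h))]
    · exact hf.comp ((PiLp.volume_preserving_toLp _).measurable.comp
        (MeasurableEquiv.measurable _))
  | succ m ih =>
    have mcons : Measurable fun z : ℝ × Rd (m + 2) =>
        (WithLp.toLp 2 (Fin.cons (α := fun _ => ℝ) z.1 z.2.ofLp) : Rd (m + 3)) := by
      refine (PiLp.volume_preserving_toLp _).measurable.comp (measurable_pi_lambda _ fun k => ?_)
      refine Fin.cases ?_ (fun k => ?_) k
      · simpa using measurable_fst
      · simp only [Fin.cons_succ]; fun_prop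
    have mP := measurable_polarPoint (m + 2)
    have mJ := measurable_polarJacobian (m + 2)
    rw [lintegral_euclidean_succ _ f hf]
    have s1 : ∀ a : ℝ, ∫⁻ t : Rd (m + 2), f (WithLp.toLp 2 (Fin.cons (α := fun _ => ℝ) a t.ofLp)) =
        ∫⁻ ω in angleBox (m + 2), ∫⁻ ρ in Ioi (0 : ℝ),
          f (WithLp.toLp 2 (Fin.cons (α := fun _ => ℝ) a (ρ • polarPoint (m + 2) ω).ofLp)) *
          (ENNReal.ofReal (ρ ^ (m + 1)) * ENNReal.ofReal (polarJacobian (m + 2) ω)) := fun a =>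
      ih (fun t => f (WithLp.toLp 2 (Fin.cons (α := fun _ => ℝ) a t.ofLp)))
        (hf.comp (mcons.comp measurable_prodMk_left))
    simp_rw [s1]
    have mF : Measurable fun z : (Fin (m + 2 - 1) → ℝ) × ℝ × ℝ =>
        f (WithLp.toLp 2 (Fin.cons (α := fun _ => ℝ) z.2.1 (z.2.2 • polarPoint (m + 2) z.1).ofLp)) *
          (ENNReal.ofReal (z.2.2 ^ (m + 1)) * ENNReal.ofReal (polarJacobian (m + 2) z.1)) := by
      have h1 : Measurable fun z : (Fin (m + 2 - 1) → ℝ) × ℝ × ℝ =>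
          z.2.2 • polarPoint (m + 2) z.1 := by fun_prop
      refine Measurable.mul (hf.comp (mcons.comp (Measurable.prodMk ?_ h1))) ?_ <;> fun_prop
    -- With $\omega$ outermost, the two inner variables range over the upper half-plane. Its
    -- Jacobian $\rho$ times $(\rho\sin a)^{m+1}$ produces $\rho^{m+2}\sin^{m+1}a$.
    rw [lintegral_lintegral_swap]
    · have s2 : ∀ ω, ∫⁻ a : ℝ, ∫⁻ ρ in Ioi (0 : ℝ),
          f (WithLp.toLp 2 (Fin.cons (α := fun _ => ℝ) a (ρ • polarPoint (m + 2) ω).ofLp)) *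
          (ENNReal.ofReal (ρ ^ (m + 1)) * ENNReal.ofReal (polarJacobian (m + 2) ω)) = _ := fun ω =>
        lintegral_upperHalfPlane_polar (fun z => f (WithLp.toLp 2 (Fin.cons (α := fun _ => ℝ) z.1
          (z.2 • polarPoint (m + 2) ω).ofLp)) *
          (ENNReal.ofReal (z.2 ^ (m + 1)) * ENNReal.ofReal (polarJacobian (m + 2) ω)))
          (mF.comp measurable_prodMk_left)
      simp_rw [s2]
      rw [lintegral_angleBox_succ]
      · rw [lintegral_lintegral_swap]
        · refine setLIntegral_congr_fun measurableSet_Icc fun a ha => ?_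
          refine setLIntegral_congr_fun (measurableSet_angleBox _) fun ω _ => ?_
          refine setLIntegral_congr_fun measurableSet_Ioi fun ρ hρ => ?_
          have hs := Real.sin_nonneg_of_mem_Icc ha
          have hρ' : (0 : ℝ) ≤ ρ := le_of_lt hρ
          rw [polarPoint_cons, polarJacobian_cons]
          have e : (WithLp.toLp 2 (Fin.cons (α := fun _ => ℝ) (ρ * Real.cos a)
              ((ρ * Real.sin a) • polarPoint (m + 2) ω).ofLp) : Rd (m + 3)) =
              ρ • (WithLp.toLp 2 (Fin.cons (n := m + 2) (α := fun _ => ℝ) (Real.cos a)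
                fun k => Real.sin a * polarPoint (m + 2) ω k) : Rd (m + 3)) := by
            ext k
            refine Fin.cases ?_ (fun k => ?_) k
            · simp
            · simp [mul_assoc]
          rw [e, mul_assoc]
          congr 1
          rw [mul_pow, ENNReal.ofReal_mul (by positivity), ENNReal.ofReal_mul (by positivity),
            pow_succ ρ (m + 1), ENNReal.ofReal_mul (by positivity)]
          ring
        · refine aemeasurable_uncurry_lintegral _ ?_ _ _
          refine Measurable.mul ?_ (by fun_prop)
          exact mF.comp (f := fun z : ((Fin (m + 2 - 1) → ℝ) × ℝ) × ℝ =>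
            (z.1.1, z.2 * Real.cos z.1.2, z.2 * Real.sin z.1.2)) (by fun_prop)
      · refine Measurable.lintegral_prod_right' (f := fun z : (Fin (m + 3 - 1) → ℝ) × ℝ =>
          f (z.2 • polarPoint (m + 3) z.1) * (ENNReal.ofReal (z.2 ^ (m + 2)) *
            ENNReal.ofReal (polarJacobian (m + 3) z.1))) ?_
        have mP' := measurable_polarPoint (m + 3)
        have mJ' := measurable_polarJacobian (m + 3)
        have h1 : Measurable fun z : (Fin (m + 3 - 1) → ℝ) × ℝ => z.2 • polarPoint (m + 3) z.1 := by
          fun_prop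
        exact Measurable.mul (hf.comp h1) (by fun_prop)
    · refine aemeasurable_uncurry_lintegral _ ?_ _ _
      exact mF.comp (f := fun z : (ℝ × (Fin (m + 2 - 1) → ℝ)) × ℝ => (z.1.2, z.1.1, z.2))
        (by fun_prop)

/-- Homogeneity is assumed only away from the origin, so rays must start at nonzero points. -/
theorem polarPoint_ne_zero {d : ℕ} (hd : 1 ≤ d) (ω : Fin (d - 1) → ℝ) : polarPoint d ω ≠ 0 := by
  obtain rfl | ⟨m, rfl⟩ : d = 1 ∨ ∃ m, d = m + 2 := by
    rcases d with _ | _ | m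
    · omega
    · exact Or.inl rfl
    · exact Or.inr ⟨m, rfl⟩
  · intro h
    have := congrArg (fun t : Rd 1 => t 0) h
    simp [polarPoint] at this
  · induction m with
    | zero =>
      intro h
      have h0 : polarPoint 2 ω 0 = 0 := by rw [h]; rfl
      have h1 : polarPoint 2 ω 1 = 0 := by rw [h]; rfl
      simp [polarPoint] at h0 h1
      have := Real.sin_sq_add_cos_sq (ω 0)
      rw [h0, h1] at this
      norm_num at this
    | succ m ih =>
      obtain ⟨a, ω', rfl⟩ : ∃ (a : ℝ) (ω' : Fin (m + 2 - 1) → ℝ),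
          ω = Fin.cons (n := m + 1) (α := fun _ => ℝ) a ω' :=
        ⟨ω (0 : Fin (m + 2)), Fin.tail (n := m + 1) (α := fun _ => ℝ) ω,
          (Fin.cons_self_tail (n := m + 1) (α := fun _ => ℝ) ω).symm⟩
      intro h
      rw [polarPoint_cons] at h
      have h0 := congrArg (fun t : Rd (m + 3) => t 0) h
      simp only [Fin.cons_zero, PiLp.zero_apply] at h0
      have hs : Real.sin a ≠ 0 := fun hs => by
        have := Real.sin_sq_add_cos_sq a
        rw [h0, hs] at this
        norm_num at this
      refine ih (by omega) ω' ?_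
      ext k
      have hk := congrArg (fun t : Rd (m + 3) => t k.succ) h
      simp only [Fin.cons_succ, PiLp.zero_apply] at hk
      exact (mul_eq_zero.1 hk).resolve_left hs

theorem angularIntegral_congr {d : ℕ} (hd : 1 ≤ d) {f g : Rd d → ℝ≥0∞}
    (h : ∀ t, t ≠ 0 → f t = g t) : angularIntegral d f = angularIntegral d g := by
  have hp := polarPoint_ne_zero hd
  unfold angularIntegral
  split_ifs
  · rw [h _ (hp _), h _ (neg_ne_zero.2 (hp _))]
  · exact lintegral_congr fun ω => by rw [h _ (hp _)]

theorem angularIntegral_const_mul (d : ℕ) {c : ℝ≥0∞} (hc : c ≠ ∞) (f : Rd d → ℝ≥0∞) :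
    angularIntegral d (fun t => c * f t) = c * angularIntegral d f := by
  unfold angularIntegral
  split_ifs
  · rw [mul_add]
  · rw [← lintegral_const_mul' _ _ hc]
    exact lintegral_congr fun ω => by rw [mul_assoc]

/-- The measurable case, applied to indicators, says that Lebesgue measure is the image under
$(\omega,\rho)\mapsto\rho\,\theta(\omega)$ of the product measure with the Jacobian as density.
Almost everywhere measurability can then be pulled back along this map. -/
theorem lintegral_polar_of_aemeasurable (m : ℕ) (f : Rd (m + 2) → ℝ≥0∞) (hf : AEMeasurable f) :
    ∫⁻ t, f t = ∫⁻ ω in angleBox (m + 2), ∫⁻ ρ in Ioi (0 : ℝ),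
      f (ρ • polarPoint (m + 2) ω) *
        (ENNReal.ofReal (ρ ^ (m + 1)) * ENNReal.ofReal (polarJacobian (m + 2) ω)) := by
  have mP := measurable_polarPoint (m + 2)
  have mJ := measurable_polarJacobian (m + 2)
  set κ : (Fin (m + 2 - 1) → ℝ) × ℝ → ℝ≥0∞ := fun z =>
    ENNReal.ofReal (z.2 ^ (m + 1)) * ENNReal.ofReal (polarJacobian (m + 2) z.1) with hκ
  have mκ : Measurable κ := by fun_prop
  set Φ : (Fin (m + 2 - 1) → ℝ) × ℝ → Rd (m + 2) := fun z => z.2 • polarPoint (m + 2) z.1 with hΦ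
  have mΦ : Measurable Φ := by fun_prop
  set μ : Measure ((Fin (m + 2 - 1) → ℝ) × ℝ) :=
    (volume.restrict (angleBox (m + 2))).prod (volume.restrict (Ioi (0 : ℝ))) with hμ
  have key : ∀ g : Rd (m + 2) → ℝ≥0∞, Measurable g → ∫⁻ t, g t = ∫⁻ z, κ z * g (Φ z) ∂μ := by
    intro g hg
    rw [lintegral_polar_of_measurable m g hg, lintegral_prod]
    · simp only [hκ, hΦ, mul_comm (g _)]
    · exact (mκ.mul (hg.comp mΦ)).aemeasurable
  have hmap : Measure.map Φ (μ.withDensity κ) = volume := by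
    ext s hs
    rw [Measure.map_apply mΦ hs, withDensity_apply _ (mΦ hs),
      ← lintegral_indicator_one hs, key _ (measurable_one.indicator hs),
      ← lintegral_indicator (mΦ hs)]
    refine lintegral_congr fun z => ?_
    by_cases hz : Φ z ∈ s
    · rw [indicator_of_mem hz, indicator_of_mem (show z ∈ Φ ⁻¹' s from hz)]; simp
    · rw [indicator_of_notMem hz, indicator_of_notMem (show z ∉ Φ ⁻¹' s from hz)]; simp
  have hf' : AEMeasurable f (Measure.map Φ (μ.withDensity κ)) := by rwa [hmap]
  have hfΦ : AEMeasurable (fun z => f (Φ z)) (μ.withDensity κ) := hf'.comp_measurable mΦ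
  have hprod : AEMeasurable (fun z => κ z * f (Φ z)) μ := by
    -- The composition is a.e. measurable only for the weighted measure; multiplying by the density
    -- removes the set where the density vanishes. The criterion used needs a density with values in
    -- `NNReal`.
    have hκ' : κ = fun z => (((z.2 ^ (m + 1)).toNNReal *
        (polarJacobian (m + 2) z.1).toNNReal : NNReal) : ℝ≥0∞) := by
      funext z
      rw [ENNReal.coe_mul]
      rfl
    rw [hκ'] at hfΦ ⊢
    exact (aemeasurable_withDensity_ennreal_iff (by fun_prop)).1 hfΦ
  calc ∫⁻ t, f t = ∫⁻ t, f t ∂(Measure.map Φ (μ.withDensity κ)) := by rw [hmap]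
    _ = ∫⁻ z, f (Φ z) ∂(μ.withDensity κ) := lintegral_map' hf' mΦ.aemeasurable
    _ = ∫⁻ z, κ z * f (Φ z) ∂μ := by
      rw [lintegral_withDensity_eq_lintegral_mul₀' mκ.aemeasurable hfΦ]; rfl
    _ = _ := by
      rw [lintegral_prod _ hprod]
      simp only [hκ, hΦ, mul_comm (f _)]

theorem lintegral_line_polar (f : Rd 1 → ℝ≥0∞) (e : Rd 1) (he : e = WithLp.toLp 2 fun _ => 1) :
    ∫⁻ t, f t = (∫⁻ ρ in Ioi (0 : ℝ), f (ρ • e)) + ∫⁻ ρ in Ioi (0 : ℝ), f (ρ • -e) := by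
  have h1 := (PiLp.volume_preserving_toLp (Fin 1)).lintegral_comp_emb
    (MeasurableEquiv.toLp 2 (Fin 1 → ℝ)).measurableEmbedding f
  have h2 := (volume_preserving_funUnique (Fin 1) ℝ).symm.lintegral_comp_emb
    (MeasurableEquiv.measurableEmbedding _) (fun u => f (WithLp.toLp 2 u))
  have h3 := ((Measure.measurePreserving_neg (volume : Measure ℝ)).restrict_preimage_emb
    (MeasurableEquiv.neg ℝ).measurableEmbedding (Iio 0)).lintegral_comp_emb
    (MeasurableEquiv.neg ℝ).measurableEmbedding (fun x => f (x • e))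
  have h4 : ∀ x : ℝ, f (WithLp.toLp 2 ((MeasurableEquiv.funUnique (Fin 1) ℝ).symm x)) = f (x • e) := by
    intro x
    congr 1
    ext k
    simp [he]
  rw [← h1]
  refine h2.symm.trans ?_
  simp_rw [h4]
  rw [← lintegral_add_compl _ (measurableSet_Ioi (a := (0 : ℝ))), compl_Ioi,
    setLIntegral_congr Iio_ae_eq_Iic.symm, ← h3]
  simp

theorem lintegral_eq_angularIntegral {d : ℕ} (hd : 1 ≤ d) {f : Rd d → ℝ≥0∞} (hf : AEMeasurable f) :
    ∫⁻ t, f t = angularIntegral d fun t =>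
      ∫⁻ ρ in Ioi (0 : ℝ), f (ρ • t) * ENNReal.ofReal (ρ ^ (d - 1)) := by
  obtain rfl | ⟨m, rfl⟩ : d = 1 ∨ ∃ m, d = m + 2 := by
    rcases d with _ | _ | m
    · omega
    · exact Or.inl rfl
    · exact Or.inr ⟨m, rfl⟩
  · rw [angularIntegral, if_pos rfl, lintegral_line_polar f (polarPoint 1 0)]
    · simp
    · ext k
      simp [polarPoint]
  · rw [lintegral_polar_of_aemeasurable m f hf, angularIntegral, if_neg (by omega)]
    refine lintegral_congr fun ω => ?_
    rw [← lintegral_mul_const' _ _ ENNReal.ofReal_ne_top]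
    simp only [mul_assoc]
    rfl

/-! ### Beta integrals along rays -/

/-- This is the normalization of the beta distribution, cleared of its constant. -/
theorem lintegral_rpow_mul_one_sub_rpow {a b : ℝ} (ha : 0 < a) (hb : 0 < b) :
    ∫⁻ u in Ioo (0 : ℝ) 1, ENNReal.ofReal (u ^ (a - 1) * (1 - u) ^ (b - 1)) =
      ENNReal.ofReal (ProbabilityTheory.beta a b) := by
  have hB := ProbabilityTheory.beta_pos ha hb
  have h1 := ProbabilityTheory.lintegral_betaPDF_eq_one ha hb
  rw [ProbabilityTheory.lintegral_betaPDF] at h1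
  have h2 : ∀ u : ℝ, ENNReal.ofReal (u ^ (a - 1) * (1 - u) ^ (b - 1)) =
      ENNReal.ofReal (ProbabilityTheory.beta a b) *
        ENNReal.ofReal (1 / ProbabilityTheory.beta a b * u ^ (a - 1) * (1 - u) ^ (b - 1)) := by
    intro u
    rw [← ENNReal.ofReal_mul hB.le]
    congr 1
    field_simp
  simp_rw [h2]
  rw [lintegral_const_mul' _ _ ENNReal.ofReal_ne_top, h1, mul_one]

theorem image_const_mul_rpow_Ioi {c k : ℝ} (hc : 0 < c) (hk : k ≠ 0) :
    (fun ρ : ℝ => c * ρ ^ (2 * k)) '' Ioi 0 = Ioi 0 := by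
  ext u
  constructor
  · rintro ⟨ρ, hρ, rfl⟩
    exact mul_pos hc (Real.rpow_pos_of_pos hρ _)
  · intro hu
    have hu' : 0 < u / c := div_pos hu hc
    refine ⟨(u / c) ^ (2 * k)⁻¹, Real.rpow_pos_of_pos hu' _, ?_⟩
    have : 2 * k ≠ 0 := by simpa using hk
    simp only
    rw [← Real.rpow_mul hu'.le, inv_mul_cancel₀ this, Real.rpow_one]
    field_simp

theorem injOn_const_mul_rpow {c k : ℝ} (hc : 0 < c) (hk : k ≠ 0) :
    InjOn (fun ρ : ℝ => c * ρ ^ (2 * k)) (Ioi 0) := by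
  intro a ha b hb hab
  have h1 : a ^ (2 * k) = b ^ (2 * k) := mul_left_cancel₀ hc.ne' hab
  have : 2 * k ≠ 0 := by simpa using hk
  exact (Real.rpow_left_inj (le_of_lt ha) (le_of_lt hb) this).1 h1

/-- The substitution `u = c ρ^{2k}` turns a radial integral into a beta integral. -/
theorem lintegral_radial_beta {c k e i j : ℝ} (hc : 0 < c) (hk : k ≠ 0)
    (hi : 0 < e / (2 * k) + i) (hj : 0 < j) :
    ∫⁻ ρ in Ioi (0 : ℝ), ENNReal.ofReal (ρ ^ (e - 1) * ((Iio 1).indicator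
        (fun u => u ^ i * (1 - u) ^ (j - 1)) (c * ρ ^ (2 * k)))) =
      ENNReal.ofReal (c ^ (-(e / (2 * k))) / (2 * |k|) *
        ProbabilityTheory.beta (e / (2 * k) + i) j) := by
  set X := e / (2 * k) with hX
  have h2k : 2 * k ≠ 0 := by simpa using hk
  have hder : ∀ ρ ∈ Ioi (0 : ℝ), HasDerivWithinAt (fun ρ : ℝ => c * ρ ^ (2 * k))
      (c * (2 * k * ρ ^ (2 * k - 1))) (Ioi 0) ρ := fun ρ hρ =>
    ((Real.hasDerivAt_rpow_const (Or.inl (ne_of_gt hρ))).const_mul c).hasDerivWithinAt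
  -- With $X=e/2k$ one has $\rho^e=c^{-X}u^X$ and $d\rho/\rho=du/(2ku)$. The absolute derivative
  -- covers both signs of $k$.
  have hsub := lintegral_image_eq_lintegral_abs_deriv_mul measurableSet_Ioi hder
    (injOn_const_mul_rpow hc hk) (fun u => ENNReal.ofReal (c ^ (-X) / (2 * |k|)) *
      ENNReal.ofReal ((Iio 1).indicator (fun u => u ^ (X + i - 1) * (1 - u) ^ (j - 1)) u))
  rw [image_const_mul_rpow_Ioi hc hk] at hsub
  have hl : ∫⁻ u in Ioi (0 : ℝ), ENNReal.ofReal (c ^ (-X) / (2 * |k|)) *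
      ENNReal.ofReal ((Iio 1).indicator (fun u => u ^ (X + i - 1) * (1 - u) ^ (j - 1)) u) =
      ENNReal.ofReal (c ^ (-X) / (2 * |k|) * ProbabilityTheory.beta (X + i) j) := by
    rw [lintegral_const_mul' _ _ ENNReal.ofReal_ne_top, ENNReal.ofReal_mul (by positivity),
      ← lintegral_rpow_mul_one_sub_rpow hi hj]
    congr 1
    rw [← lintegral_indicator measurableSet_Ioi, ← lintegral_indicator measurableSet_Ioo]
    refine lintegral_congr fun u => ?_
    by_cases h0 : u ∈ Ioi (0 : ℝ)
    · rw [indicator_of_mem h0]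
      by_cases h1 : u ∈ Iio (1 : ℝ)
      · rw [indicator_of_mem h1, indicator_of_mem (show u ∈ Ioo (0 : ℝ) 1 from ⟨h0, h1⟩)]
      · rw [indicator_of_notMem h1, indicator_of_notMem (fun h => h1 h.2)]
        simp
    · rw [indicator_of_notMem h0, indicator_of_notMem (fun h => h0 h.1)]
  rw [← hl, hsub]
  refine setLIntegral_congr_fun measurableSet_Ioi fun ρ (hρ : 0 < ρ) => ?_
  rw [← ENNReal.ofReal_mul (by positivity), ← ENNReal.ofReal_mul (by positivity)]
  congr 1
  by_cases h1 : c * ρ ^ (2 * k) ∈ Iio (1 : ℝ)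
  · rw [indicator_of_mem h1, indicator_of_mem h1]
    have hu : 0 < c * ρ ^ (2 * k) := by positivity
    rw [abs_mul, abs_mul, abs_mul, abs_of_pos hc, abs_of_pos (Real.rpow_pos_of_pos hρ _),
      abs_two]
    have hpow : (c * ρ ^ (2 * k)) ^ (X + i - 1) =
        c ^ X * ρ ^ e * (c * ρ ^ (2 * k)) ^ i / (c * ρ ^ (2 * k)) := by
      rw [Real.rpow_sub_one hu.ne', Real.rpow_add hu, Real.mul_rpow hc.le (by positivity),
        ← Real.rpow_mul hρ.le, hX, mul_div_cancel₀ _ h2k]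
    rw [hpow, Real.rpow_neg hc.le, Real.rpow_sub_one hρ.ne', Real.rpow_sub_one hρ.ne']
    have hk' : |k| ≠ 0 := abs_ne_zero.2 hk
    have : c ^ X ≠ 0 := by positivity
    have : ρ ^ (2 * k) ≠ 0 := by positivity
    field_simp
  · rw [indicator_of_notMem h1, indicator_of_notMem h1]
    simp

/-- The positive part of `|ψ|² - b s₂`. -/
def excess {d n : ℕ} (ψ : Rd d → ℂ) (φ : Fin n → Rd d → ℂ) (b : ℝ) (t : Rd d) : ℝ :=
  max (‖ψ t‖ ^ 2 - b * s2 φ t) 0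

/-! ### Homogeneity and integrals of the excess -/

section basic

variable {d n : ℕ} {ψ : Rd d → ℂ} {φ : Fin n → Rd d → ℂ} {b ν η : ℝ}

theorem excess_nonneg (t : Rd d) : 0 ≤ excess ψ φ b t := le_max_right _ _

theorem s2_nonneg (t : Rd d) : 0 ≤ s2 φ t := Finset.sum_nonneg fun _ _ => by positivity

theorem s2_smul (hφ : ∀ j, IsAbsHomogeneous (φ j) ν) {ρ : ℝ} (hρ : 0 < ρ) {t : Rd d} (ht : t ≠ 0) :
    s2 φ (ρ • t) = ρ ^ (2 * ν) * s2 φ t := by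
  unfold s2
  rw [Finset.mul_sum]
  refine Finset.sum_congr rfl fun j _ => ?_
  rw [hφ j ρ hρ t ht, mul_pow, two_mul, Real.rpow_add hρ, sq (ρ ^ ν)]

theorem norm_sq_smul {f : Rd d → ℂ} (hf : IsAbsHomogeneous f η) {ρ : ℝ} (hρ : 0 < ρ) {t : Rd d}
    (ht : t ≠ 0) : ‖f (ρ • t)‖ ^ 2 = ρ ^ (2 * η) * ‖f t‖ ^ 2 := by
  rw [hf ρ hρ t ht, mul_pow, two_mul, Real.rpow_add hρ, sq (ρ ^ η)]

theorem aemeasurable_s2 (hφ : ∀ j, AEStronglyMeasurable (φ j) volume) : AEMeasurable (s2 φ) := by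
  unfold s2
  refine Finset.aemeasurable_fun_sum _ fun j _ => ?_
  exact (hφ j).norm.aemeasurable.pow_const 2

theorem aemeasurable_excess (hψ : AEStronglyMeasurable ψ volume)
    (hφ : ∀ j, AEStronglyMeasurable (φ j) volume) : AEMeasurable (excess ψ φ b) :=
  ((hψ.norm.aemeasurable.pow_const 2).sub ((aemeasurable_s2 hφ).const_mul b)).max aemeasurable_const

theorem s2_ne_zero_ae (hφ0 : ∀ᵐ t : Rd d, ∑ j, ‖φ j t‖ ≠ 0) : ∀ᵐ t : Rd d, s2 φ t ≠ 0 := by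
  filter_upwards [hφ0] with t ht h
  refine ht (Finset.sum_eq_zero fun j hj => ?_)
  have := (Finset.sum_eq_zero_iff_of_nonneg (f := fun j => ‖φ j t‖ ^ 2)
    (fun _ _ => by positivity)).1 h j hj
  exact pow_eq_zero_iff two_ne_zero |>.1 this

end basic

/-- The excess along a ray, in the variable `u = b S ρ^{2(ν-η)} / W²`. -/
theorem excess_ray {W S b ν η ρ : ℝ} (hW : 0 < W) (hρ : 0 < ρ) :
    ρ ^ (2 * η) * W ^ 2 - b * (ρ ^ (2 * ν) * S) =
      ρ ^ (2 * η) * W ^ 2 * (1 - b * S / W ^ 2 * ρ ^ (2 * (ν - η))) := by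
  have : ρ ^ (2 * ν) = ρ ^ (2 * η) * ρ ^ (2 * (ν - η)) := by
    rw [← Real.rpow_add hρ]; ring_nf
  rw [this]
  field_simp

/-- Hypothesis `hX` is the balance of homogeneities that collects all powers of $\rho$ into
$\rho^{2kX-1}$. The exponents $(i,j)=(0,y+1)$ serve $\int K^y$, and $(1,y)$ serve the integrals of
$bPK^{y-1}$. -/
theorem lintegral_ray {d : ℕ} (hd : 1 ≤ d) {W S b k η y X i j : ℝ} (hW : 0 < W) (hS : 0 < S)
    (hb : 0 < b) (hk : k ≠ 0) (hX : d + 2 * η * y = 2 * k * X) (hi : 0 < X + i) (hj : 0 < j) :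
    ∫⁻ ρ in Ioi (0 : ℝ), ENNReal.ofReal ((ρ ^ (2 * η) * W ^ 2) ^ y * ((Iio 1).indicator
        (fun u => u ^ i * (1 - u) ^ (j - 1)) (b * S / W ^ 2 * ρ ^ (2 * k)))) *
        ENNReal.ofReal (ρ ^ (d - 1)) =
      ENNReal.ofReal (b ^ (-X) / (2 * |k|) * ProbabilityTheory.beta (X + i) j) *
        ENNReal.ofReal (W ^ (2 * y + 2 * X) / S ^ X) := by
  have hc : 0 < b * S / W ^ 2 := by positivity
  have hX' : 2 * k * X / (2 * k) = X := mul_div_cancel_left₀ _ (by simpa using hk)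
  have key := lintegral_radial_beta (e := 2 * k * X) (i := i) hc hk (by rwa [hX']) hj
  rw [hX'] at key
  have hpos : 0 < W ^ (2 * y) := by positivity
  calc _ = ∫⁻ ρ in Ioi (0 : ℝ), ENNReal.ofReal (W ^ (2 * y)) * ENNReal.ofReal (ρ ^ (2 * k * X - 1) *
        ((Iio 1).indicator (fun u => u ^ i * (1 - u) ^ (j - 1)) (b * S / W ^ 2 * ρ ^ (2 * k)))) := by
        refine setLIntegral_congr_fun measurableSet_Ioi fun ρ (hρ : 0 < ρ) => ?_
        rw [← ENNReal.ofReal_mul' (by positivity), ← ENNReal.ofReal_mul hpos.le]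
        congr 1
        have e1 : (ρ ^ (2 * η) * W ^ 2) ^ y = ρ ^ (2 * η * y) * W ^ (2 * y) := by
          rw [Real.mul_rpow (by positivity) (by positivity), ← Real.rpow_mul hρ.le,
            ← Real.rpow_natCast_mul hW.le]
          norm_num
        have e2 : ρ ^ (2 * k * X - 1) = ρ ^ (2 * η * y) * ρ ^ (d - 1) := by
          rw [← Real.rpow_natCast, ← Real.rpow_add hρ, Nat.cast_sub hd, ← hX]
          congr 1
          push_cast
          ring
        rw [e1, e2]
        ring
    _ = _ := by
        rw [lintegral_const_mul' _ _ ENNReal.ofReal_ne_top, key, ← ENNReal.ofReal_mul hpos.le,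
          ← ENNReal.ofReal_mul']
        · congr 1
          have e3 : (b * S / W ^ 2) ^ (-X) = b ^ (-X) * W ^ (2 * X) / S ^ X := by
            rw [Real.rpow_neg (by positivity), Real.div_rpow (by positivity) (by positivity),
              Real.mul_rpow hb.le hS.le, ← Real.rpow_natCast_mul hW.le, Real.rpow_neg hb.le,
              inv_div]
            push_cast
            field_simp
          rw [e3, Real.rpow_add hW]
          ring
        · positivity

section polar

variable {d n : ℕ} {ψ : Rd d → ℂ} {φ : Fin n → Rd d → ℂ} {b ν η y X : ℝ}

theorem lintegral_excess_rpow (hd : 1 ≤ d) (hψm : AEStronglyMeasurable ψ volume)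
    (hφm : ∀ j, AEStronglyMeasurable (φ j) volume)
    (hψ : IsAbsHomogeneous ψ η) (hφ : ∀ j, IsAbsHomogeneous (φ j) ν)
    (hs : ∀ᵐ t : Rd d, s2 φ t ≠ 0) (hk : ν - η ≠ 0) (hy : 0 < y) (hX0 : 0 < X)
    (hX : d + 2 * η * y = 2 * (ν - η) * X) (hb : 0 < b) :
    ∫⁻ t, ENNReal.ofReal (excess ψ φ b t ^ y) =
      ENNReal.ofReal (b ^ (-X) / (2 * |ν - η|) * ProbabilityTheory.beta X (y + 1)) *
        angularIntegral d fun t => ENNReal.ofReal (‖ψ t‖ ^ (2 * y + 2 * X) / s2 φ t ^ X) := by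
  -- On a ray with $s_2=0$ the excess is $|\psi|^2$ throughout and its radial integral may diverge,
  -- while the angular integrand on the right is $0$ there, by division by zero. Setting the
  -- integrand to $0$ on this null set makes the identity hold on every ray.
  set g : Rd d → ℝ≥0∞ := fun t =>
    if s2 φ t = 0 then 0 else ENNReal.ofReal (excess ψ φ b t ^ y) with hg
  have hae : (fun t => ENNReal.ofReal (excess ψ φ b t ^ y)) =ᵐ[volume] g := by
    filter_upwards [hs] with t ht
    simp [hg, ht]
  have hgm : AEMeasurable g :=
    AEMeasurable.congr ((aemeasurable_excess hψm hφm).pow_const y).ennreal_ofReal hae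
  rw [lintegral_congr_ae hae, lintegral_eq_angularIntegral hd hgm,
    ← angularIntegral_const_mul _ ENNReal.ofReal_ne_top]
  refine angularIntegral_congr hd fun t ht => ?_
  rcases (s2_nonneg (φ := φ) t).eq_or_lt with hS | hS
  · rw [setLIntegral_eq_zero measurableSet_Ioi, ← hS, Real.zero_rpow hX0.ne']
    · simp
    · intro ρ hρ
      simp [hg, s2_smul hφ hρ ht, ← hS]
  rcases (norm_nonneg (ψ t)).eq_or_lt with hW | hW
  · rw [setLIntegral_eq_zero measurableSet_Ioi, ← hW, Real.zero_rpow (by positivity)]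
    · simp
    · intro ρ hρ
      have : excess ψ φ b (ρ • t) = 0 := by
        unfold excess
        rw [norm_sq_smul hψ hρ ht, ← hW, max_eq_right]
        have := s2_nonneg (φ := φ) (ρ • t)
        nlinarith
      simp [hg, this, Real.zero_rpow hy.ne']
  have key := lintegral_ray (i := 0) (j := y + 1) hd hW hS hb hk hX (by simpa using hX0)
    (by positivity)
  rw [add_zero] at key
  rw [← key]
  refine setLIntegral_congr_fun measurableSet_Ioi fun ρ (hρ : 0 < ρ) => ?_
  have hne : s2 φ (ρ • t) ≠ 0 := by
    rw [s2_smul hφ hρ ht]; positivity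
  simp only [hg, hne, if_false]
  congr 2
  unfold excess
  rw [norm_sq_smul hψ hρ ht, s2_smul hφ hρ ht, excess_ray hW hρ]
  set u := b * s2 φ t / ‖ψ t‖ ^ 2 * ρ ^ (2 * (ν - η)) with hu
  have hp : 0 < ρ ^ (2 * η) * ‖ψ t‖ ^ 2 := by positivity
  by_cases h1 : u ∈ Iio (1 : ℝ)
  · have h1' : 0 < 1 - u := sub_pos.2 h1
    rw [indicator_of_mem h1, max_eq_left (by positivity), Real.mul_rpow hp.le h1'.le]
    simp
  · rw [indicator_of_notMem h1, max_eq_right, Real.zero_rpow hy.ne', mul_zero]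
    exact mul_nonpos_of_nonneg_of_nonpos hp.le (sub_nonpos.2 (not_lt.1 h1))

/-- Applied with $P=s_2$ and with $P=|\varphi_j|^2$. The ratio $P/s_2$ is constant along rays, so
only the beta exponents change compared with $\int K^y$. -/
theorem lintegral_mul_excess_rpow (hd : 1 ≤ d) (hψm : AEStronglyMeasurable ψ volume)
    (hφm : ∀ j, AEStronglyMeasurable (φ j) volume)
    (hψ : IsAbsHomogeneous ψ η) (hφ : ∀ j, IsAbsHomogeneous (φ j) ν)
    (hs : ∀ᵐ t : Rd d, s2 φ t ≠ 0) (hk : ν - η ≠ 0) (hy : 0 < y) (hX0 : 0 < X)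
    (hX : d + 2 * η * y = 2 * (ν - η) * X) (hb : 0 < b)
    {P : Rd d → ℝ} (hPm : AEMeasurable P) (hP0 : ∀ t, 0 ≤ P t)
    (hPhom : ∀ ρ : ℝ, 0 < ρ → ∀ t, t ≠ 0 → P (ρ • t) = ρ ^ (2 * ν) * P t) :
    ∫⁻ t, ENNReal.ofReal (b * P t * (excess ψ φ b t ^ y / excess ψ φ b t)) =
      ENNReal.ofReal (b ^ (-X) / (2 * |ν - η|) * ProbabilityTheory.beta (X + 1) y) *
        angularIntegral d fun t =>
          ENNReal.ofReal (‖ψ t‖ ^ (2 * y + 2 * X) * P t / s2 φ t ^ (X + 1)) := by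
  set g : Rd d → ℝ≥0∞ := fun t => if s2 φ t = 0 then 0 else
    ENNReal.ofReal (b * P t * (excess ψ φ b t ^ y / excess ψ φ b t)) with hg
  have hae : (fun t => ENNReal.ofReal (b * P t * (excess ψ φ b t ^ y / excess ψ φ b t)))
      =ᵐ[volume] g := by
    filter_upwards [hs] with t ht
    simp [hg, ht]
  have hgm : AEMeasurable g := by
    refine AEMeasurable.congr ?_ hae
    have := aemeasurable_excess (b := b) hψm hφm
    exact ((hPm.const_mul b).mul ((this.pow_const y).div this)).ennreal_ofReal
  rw [lintegral_congr_ae hae, lintegral_eq_angularIntegral hd hgm,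
    ← angularIntegral_const_mul _ ENNReal.ofReal_ne_top]
  refine angularIntegral_congr hd fun t ht => ?_
  rcases (s2_nonneg (φ := φ) t).eq_or_lt with hS | hS
  · rw [setLIntegral_eq_zero measurableSet_Ioi, ← hS, Real.zero_rpow (by positivity)]
    · simp
    · intro ρ hρ
      simp [hg, s2_smul hφ hρ ht, ← hS]
  rcases (norm_nonneg (ψ t)).eq_or_lt with hW | hW
  · rw [setLIntegral_eq_zero measurableSet_Ioi, ← hW, Real.zero_rpow (by positivity)]
    · simp
    · intro ρ hρ
      have : excess ψ φ b (ρ • t) = 0 := by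
        unfold excess
        rw [norm_sq_smul hψ hρ ht, ← hW, max_eq_right]
        have := s2_nonneg (φ := φ) (ρ • t)
        nlinarith
      simp [hg, this, Real.zero_rpow hy.ne']
  have key := lintegral_ray (i := 1) (j := y) hd hW hS hb hk hX (by positivity) hy
  have hsplit : ENNReal.ofReal (‖ψ t‖ ^ (2 * y + 2 * X) * P t / s2 φ t ^ (X + 1)) =
      ENNReal.ofReal (‖ψ t‖ ^ (2 * y + 2 * X) / s2 φ t ^ X) * ENNReal.ofReal (P t / s2 φ t) := by
    rw [← ENNReal.ofReal_mul (by positivity), Real.rpow_add_one hS.ne']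
    congr 1
    field_simp
  rw [hsplit, ← mul_assoc, ← key, ← lintegral_mul_const' _ _ ENNReal.ofReal_ne_top]
  refine setLIntegral_congr_fun measurableSet_Ioi fun ρ (hρ : 0 < ρ) => ?_
  have hne : s2 φ (ρ • t) ≠ 0 := by
    rw [s2_smul hφ hρ ht]; positivity
  simp only [hg, hne, if_false]
  rw [mul_right_comm (ENNReal.ofReal ((_ : ℝ) ^ y * _)), ← ENNReal.ofReal_mul' (div_nonneg (hP0 t) hS.le)]
  congr 2
  unfold excess
  rw [norm_sq_smul hψ hρ ht, s2_smul hφ hρ ht, excess_ray hW hρ, hPhom ρ hρ t ht]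
  set u := b * s2 φ t / ‖ψ t‖ ^ 2 * ρ ^ (2 * (ν - η)) with hu
  have hp : 0 < ρ ^ (2 * η) * ‖ψ t‖ ^ 2 := by positivity
  by_cases h1 : u ∈ Iio (1 : ℝ)
  · have h1' : 0 < 1 - u := sub_pos.2 h1
    rw [indicator_of_mem h1, max_eq_left (by positivity), Real.mul_rpow hp.le h1'.le,
      Real.rpow_one, Real.rpow_sub_one h1'.ne']
    -- On the ray $b\,s_2=|\psi|^2u$; this is the source of the extra factor $u$, hence of $i=1$.
    have e1 : b * (ρ ^ (2 * ν) * P t) = ρ ^ (2 * η) * ‖ψ t‖ ^ 2 * u * (P t / s2 φ t) := by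
      have : ρ ^ (2 * ν) = ρ ^ (2 * η) * ρ ^ (2 * (ν - η)) := by
        rw [← Real.rpow_add hρ]; ring_nf
      rw [this, hu]
      field_simp
    rw [e1]
    field_simp
  · rw [indicator_of_notMem h1, max_eq_right, Real.zero_rpow hy.ne']
    · simp
    · exact mul_nonpos_of_nonneg_of_nonpos hp.le (sub_nonpos.2 (not_lt.1 h1))

end polar

/-! ### Relations between the exponents -/

theorem beta_comm (a b : ℝ) : ProbabilityTheory.beta a b = ProbabilityTheory.beta b a := by
  unfold ProbabilityTheory.beta
  rw [add_comm, mul_comm (Real.Gamma a)]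

theorem beta_add_one_left {a b : ℝ} (ha : 0 < a) (hb : 0 < b) :
    ProbabilityTheory.beta (a + 1) b = a / (a + b) * ProbabilityTheory.beta a b := by
  unfold ProbabilityTheory.beta
  have hab : a + b ≠ 0 := by positivity
  have hG : Real.Gamma (a + b) ≠ 0 := (Real.Gamma_pos_of_pos (by positivity)).ne'
  rw [show a + 1 + b = a + b + 1 by ring, Real.Gamma_add_one ha.ne', Real.Gamma_add_one hab]
  field_simp

theorem recip_lt_half {p : ℝ≥0∞} (hp : 2 < p) : recip p < 1 / 2 := by
  unfold recip
  have h1 : p⁻¹ < 2⁻¹ := ENNReal.inv_lt_inv.2 hp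
  have h2 := (ENNReal.toReal_lt_toReal h1.ne_top (by simp)).2 h1
  simpa using h2

section parameters

variable {d : ℕ} {p : ℝ≥0∞} {ν η : ℝ}

/-- The exponent `q(1-γ)/2`. -/
def decayExp (d : ℕ) (p : ℝ≥0∞) (ν η : ℝ) : ℝ := qExp d p ν η * (1 - gam d p ν η) / 2

/-- The exponent `(p/2)'`, the conjugate of `p/2`. -/
def conjExp (p : ℝ≥0∞) : ℝ := 1 / (2 * (1 / 2 - recip p))

theorem half_sub_recip_pos (hp : 2 < p) : 0 < 1 / 2 - recip p := sub_pos.2 (recip_lt_half hp)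

theorem conjExp_pos (hp : 2 < p) : 0 < conjExp p := by
  have := half_sub_recip_pos hp
  unfold conjExp; positivity

theorem qExp_pos (hp : 2 < p) (hγ : gam d p ν η ∈ Ioo (0 : ℝ) 1) : 0 < qExp d p ν η := by
  have := half_sub_recip_pos hp
  have := hγ.1
  unfold qExp; positivity

theorem decayExp_pos (hp : 2 < p) (hγ : gam d p ν η ∈ Ioo (0 : ℝ) 1) : 0 < decayExp d p ν η := by
  have := qExp_pos hp hγ
  have := sub_pos.2 hγ.2
  unfold decayExp; positivity

theorem two_conjExp_add_two_decayExp (hp : 2 < p) (hγ : gam d p ν η ∈ Ioo (0 : ℝ) 1) :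
    2 * conjExp p + 2 * decayExp d p ν η = qExp d p ν η := by
  have := (half_sub_recip_pos hp).ne'
  have := hγ.1.ne'
  unfold conjExp decayExp qExp
  generalize 1 / 2 - recip p = h at *
  field_simp
  ring

/-- Equivalently, $\gamma$ and $1-\gamma$ are the shares of `conjExp` and `decayExp` in their sum.
These are the ratios produced by the recursion of the beta function. -/
theorem gam_mul_decayExp (hp : 2 < p) (hγ : gam d p ν η ∈ Ioo (0 : ℝ) 1) :
    gam d p ν η * decayExp d p ν η = (1 - gam d p ν η) * conjExp p := by
  have := (half_sub_recip_pos hp).ne'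
  have := hγ.1.ne'
  unfold conjExp decayExp qExp
  generalize 1 / 2 - recip p = h at *
  field_simp

theorem qExp_mul_gam_mul_recip (hp : 2 < p) (hγ : gam d p ν η ∈ Ioo (0 : ℝ) 1) :
    qExp d p ν η * gam d p ν η * recip p + 1 = conjExp p := by
  have h1 := (half_sub_recip_pos hp).ne'
  have := hγ.1.ne'
  unfold conjExp qExp
  obtain ⟨h, hh⟩ : ∃ h, h = 1 / 2 - recip p := ⟨_, rfl⟩
  rw [show recip p = 1 / 2 - h by linarith]
  rw [← hh] at h1
  simp only [sub_sub_cancel]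
  field_simp
  ring

theorem sub_ne_zero_of_gam (hγ : gam d p ν η ∈ Ioo (0 : ℝ) 1) : ν - η ≠ 0 := by
  intro h
  have := hγ.1
  rw [gam, h, zero_div] at this
  exact lt_irrefl _ this

/-- The balance condition of `lintegral_ray`; it is here that the formula for $\gamma$ in terms of
$d,\nu,\eta,p$ enters. -/
theorem add_two_mul_conjExp (hp : 2 < p) (hγ : gam d p ν η ∈ Ioo (0 : ℝ) 1) :
    d + 2 * η * conjExp p = 2 * (ν - η) * decayExp d p ν η := by
  have h1 := half_sub_recip_pos hp
  have hk := sub_ne_zero_of_gam hγ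
  have hD : ν + d * (1 / 2 - recip p) ≠ 0 := by
    intro h
    have := hγ.1
    rw [gam, h, div_zero] at this
    exact lt_irrefl _ this
  have hx := gam_mul_decayExp hp hγ
  have e : decayExp d p ν η = (1 - gam d p ν η) * conjExp p / gam d p ν η := by
    rw [← hx, mul_div_cancel_left₀ _ hγ.1.ne']
  rw [e]
  unfold conjExp gam
  generalize 1 / 2 - recip p = h at *
  field_simp
  ring

end parameters

/-- The integral of the `(p/2)'`-th power of the positive part of `|ψ|² - s₂`. -/
def levelConst {d n : ℕ} (p : ℝ≥0∞) (ν η : ℝ) (ψ : Rd d → ℂ) (φ : Fin n → Rd d → ℂ) : ℝ :=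
  gam d p ν η * (ProbabilityTheory.beta (qExp d p ν η * gam d p ν η * recip p + 1)
      (qExp d p ν η * (1 - gam d p ν η) / 2) / (2 * |ν - η|)) * (intI p ν η ψ φ).toReal

/-! ### The integrals of the excess in terms of $I$ -/

section level

variable {d n : ℕ} {p : ℝ≥0∞} {ν η : ℝ} {ψ : Rd d → ℂ} {φ : Fin n → Rd d → ℂ}

/-- The factor $\gamma$ in `levelConst` comes from $B(y+1,x)=\frac{y}{x+y}B(y,x)$ with $x$ =
`decayExp` and $y$ = `conjExp`. -/
theorem lintegral_excess (hd : 1 ≤ d) (hp : 2 < p)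
    (hψm : AEStronglyMeasurable ψ volume) (hφm : ∀ j, AEStronglyMeasurable (φ j) volume)
    (hψhom : IsAbsHomogeneous ψ η) (hφhom : ∀ j, IsAbsHomogeneous (φ j) ν)
    (hφ0 : ∀ᵐ t : Rd d, ∑ j, ‖φ j t‖ ≠ 0)
    (hγ : gam d p ν η ∈ Ioo (0 : ℝ) 1) (hI : intI p ν η ψ φ < ∞) {b : ℝ} (hb : 0 < b) :
    ∫⁻ t, ENNReal.ofReal (excess ψ φ b t ^ conjExp p) =
      ENNReal.ofReal (b ^ (-decayExp d p ν η) * levelConst p ν η ψ φ) := by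
  have hy := conjExp_pos hp
  have hx := decayExp_pos hp hγ
  have hk := sub_ne_zero_of_gam hγ
  have hk' := abs_pos.2 hk
  have h := lintegral_excess_rpow hd hψm hφm hψhom hφhom (s2_ne_zero_ae hφ0) hk hy hx
    (add_two_mul_conjExp hp hγ) hb
  rw [two_conjExp_add_two_decayExp hp hγ] at h
  refine h.trans ?_
  change _ * intI p ν η ψ φ = _
  conv_lhs => rw [← ENNReal.ofReal_toReal hI.ne]
  have hB := (ProbabilityTheory.beta_pos hx (add_pos hy one_pos)).le
  rw [← ENNReal.ofReal_mul (by positivity)]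
  congr 1
  unfold levelConst
  rw [qExp_mul_gam_mul_recip hp hγ, beta_comm, beta_add_one_left hy hx]
  change _ = _ * (_ * (ProbabilityTheory.beta _ (decayExp d p ν η) / _) * _)
  have e : conjExp p / (conjExp p + decayExp d p ν η) = gam d p ν η := by
    rw [div_eq_iff (by positivity)]
    linarith [gam_mul_decayExp hp hγ]
  rw [e]
  ring

/-- Otherwise the excess vanishes almost everywhere at every level $b=1/(m+1)$, so $|\psi|^2\le
b\,s_2$ with $b\to0$, and $\psi=0$ almost everywhere. In particular this yields $I>0$, which is not
a hypothesis. -/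
theorem levelConst_pos (hd : 1 ≤ d) (hp : 2 < p)
    (hψm : AEStronglyMeasurable ψ volume) (hφm : ∀ j, AEStronglyMeasurable (φ j) volume)
    (hψhom : IsAbsHomogeneous ψ η) (hφhom : ∀ j, IsAbsHomogeneous (φ j) ν)
    (hψ0 : ∀ᵐ t : Rd d, ψ t ≠ 0) (hφ0 : ∀ᵐ t : Rd d, ∑ j, ‖φ j t‖ ≠ 0)
    (hγ : gam d p ν η ∈ Ioo (0 : ℝ) 1) (hI : intI p ν η ψ φ < ∞) :
    0 < levelConst p ν η ψ φ := by
  have hy := conjExp_pos hp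
  by_contra hA
  have hzero : ∀ m : ℕ, ∀ᵐ t : Rd d, excess ψ φ (1 / (m + 1 : ℝ)) t = 0 := by
    intro m
    have hb : (0 : ℝ) < 1 / (m + 1 : ℝ) := by positivity
    have h := lintegral_excess hd hp hψm hφm hψhom hφhom hφ0 hγ hI hb
    rw [ENNReal.ofReal_of_nonpos
      (mul_nonpos_of_nonneg_of_nonpos (by positivity) (not_lt.1 hA))] at h
    rw [lintegral_eq_zero_iff' ((aemeasurable_excess hψm hφm).pow_const _).ennreal_ofReal] at h
    filter_upwards [h] with t ht
    have h1 : excess ψ φ (1 / (m + 1 : ℝ)) t ^ conjExp p ≤ 0 := ENNReal.ofReal_eq_zero.1 ht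
    by_contra hne
    have : 0 < excess ψ φ (1 / (m + 1 : ℝ)) t := lt_of_le_of_ne (excess_nonneg t) (Ne.symm hne)
    exact absurd h1 (not_le.2 (Real.rpow_pos_of_pos this _))
  have hfalse : ∀ᵐ _ : Rd d, False := by
    filter_upwards [ae_all_iff.2 hzero, hψ0] with t h1 h2
    have hle : ∀ m : ℕ, ‖ψ t‖ ^ 2 ≤ 1 / (m + 1 : ℝ) * s2 φ t := fun m => by
      have := le_max_left (‖ψ t‖ ^ 2 - 1 / (m + 1 : ℝ) * s2 φ t) 0
      have h3 := h1 m
      unfold excess at h3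
      linarith
    have hlim : Filter.Tendsto (fun m : ℕ => 1 / (m + 1 : ℝ) * s2 φ t) Filter.atTop (nhds 0) := by
      simpa using (tendsto_one_div_add_atTop_nhds_zero_nat (𝕜 := ℝ)).mul_const (s2 φ t)
    have := ge_of_tendsto' hlim hle
    have hpos : 0 < ‖ψ t‖ := norm_pos_iff.2 h2
    nlinarith
  have : (ae (volume : Measure (Rd d))).NeBot := ae_neBot.2 (NeZero.ne _)
  exact hfalse.exists.elim fun _ h => h

/-- Equality of the $I_j'$ makes the $n$ integrals equal, so each is one $n$-th of the integral with
$s_2$, whose angular part is $I$. The recursion of the beta function supplies $1-\gamma$ in place of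
the $\gamma$ in `levelConst`. -/
theorem lintegral_mul_excess (hd : 1 ≤ d) (hp : 2 < p)
    (hψm : AEStronglyMeasurable ψ volume) (hφm : ∀ j, AEStronglyMeasurable (φ j) volume)
    (hψhom : IsAbsHomogeneous ψ η) (hφhom : ∀ j, IsAbsHomogeneous (φ j) ν)
    (hφ0 : ∀ᵐ t : Rd d, ∑ j, ‖φ j t‖ ≠ 0)
    (hγ : gam d p ν η ∈ Ioo (0 : ℝ) 1) (hI : intI p ν η ψ φ < ∞)
    (hI' : ∀ i j, intI' p ν η ψ φ i = intI' p ν η ψ φ j) {b : ℝ} (hb : 0 < b) (j : Fin n) :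
    ∫⁻ t, ENNReal.ofReal (b * ‖φ j t‖ ^ 2 * (excess ψ φ b t ^ conjExp p / excess ψ φ b t)) =
      ENNReal.ofReal ((1 - gam d p ν η) / (gam d p ν η * n) *
        (b ^ (-decayExp d p ν η) * levelConst p ν η ψ φ)) := by
  have hy := conjExp_pos hp
  have hx := decayExp_pos hp hγ
  have hk := sub_ne_zero_of_gam hγ
  have hk' := abs_pos.2 hk
  have hn : 0 < n := Fin.pos j
  have hn' : (0 : ℝ) < n := by exact_mod_cast hn
  have hsum := lintegral_mul_excess_rpow hd hψm hφm hψhom hφhom (s2_ne_zero_ae hφ0) hk hy hx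
    (add_two_mul_conjExp hp hγ) hb (aemeasurable_s2 hφm) s2_nonneg
    (fun ρ hρ t ht => s2_smul hφhom hρ ht)
  have hj : ∀ i, _ := fun i => lintegral_mul_excess_rpow hd hψm hφm hψhom hφhom
    (s2_ne_zero_ae hφ0) hk hy hx (add_two_mul_conjExp hp hγ) hb
    (P := fun t => ‖φ i t‖ ^ 2) ((hφm i).norm.aemeasurable.pow_const 2) (fun t => by positivity)
    (fun ρ hρ t ht => norm_sq_smul (hφhom i) hρ ht)
  rw [two_conjExp_add_two_decayExp hp hγ] at hsum hj
  have heq : ∀ i, ∫⁻ t, ENNReal.ofReal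
      (b * ‖φ i t‖ ^ 2 * (excess ψ φ b t ^ conjExp p / excess ψ φ b t)) = ∫⁻ t, ENNReal.ofReal
      (b * ‖φ j t‖ ^ 2 * (excess ψ φ b t ^ conjExp p / excess ψ φ b t)) := fun i => by
    rw [hj i, hj j]
    exact congrArg _ (hI' i j)
  have hadd : ∫⁻ t, ENNReal.ofReal (b * s2 φ t * (excess ψ φ b t ^ conjExp p / excess ψ φ b t)) =
      n * ∫⁻ t, ENNReal.ofReal
        (b * ‖φ j t‖ ^ 2 * (excess ψ φ b t ^ conjExp p / excess ψ φ b t)) := by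
    have hm := aemeasurable_excess (b := b) hψm hφm
    have e : ∀ t, ENNReal.ofReal (b * s2 φ t * (excess ψ φ b t ^ conjExp p / excess ψ φ b t)) =
        ∑ i, ENNReal.ofReal
          (b * ‖φ i t‖ ^ 2 * (excess ψ φ b t ^ conjExp p / excess ψ φ b t)) := fun t => by
      have h0 := excess_nonneg (ψ := ψ) (φ := φ) (b := b) t
      rw [← ENNReal.ofReal_sum_of_nonneg fun i _ => by positivity, ← Finset.sum_mul,
        ← Finset.mul_sum]
      rfl
    simp_rw [e]
    rw [lintegral_finsetSum' _ fun i _ => ?_, Finset.sum_congr rfl fun i _ => heq i]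
    · simp
    · exact ((((hφm i).norm.aemeasurable.pow_const 2).const_mul b).mul
        ((hm.pow_const _).div hm)).ennreal_ofReal
  -- The weight $s_2$ cancels the additional power in the denominator; where $s_2=0$ both integrands
  -- are $0$.
  have hang : (angularIntegral d fun t => ENNReal.ofReal
      (‖ψ t‖ ^ qExp d p ν η * s2 φ t / s2 φ t ^ (decayExp d p ν η + 1))) = intI p ν η ψ φ := by
    refine angularIntegral_congr hd fun t _ => ?_
    congr 1
    change _ = _ / s2 φ t ^ decayExp d p ν η
    rcases (s2_nonneg (φ := φ) t).eq_or_lt with hS | hS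
    · rw [← hS, Real.zero_rpow hx.ne']; simp
    · rw [Real.rpow_add_one hS.ne']
      field_simp
  rw [hang, hadd] at hsum
  have hB := (ProbabilityTheory.beta_pos (add_pos hx one_pos) hy).le
  rw [← ENNReal.ofReal_toReal hI.ne, ← ENNReal.ofReal_mul (by positivity)] at hsum
  have hn0 : (n : ℝ≥0∞) ≠ 0 := by exact_mod_cast hn.ne'
  have hres : n * ENNReal.ofReal ((1 - gam d p ν η) / (gam d p ν η * n) *
        (b ^ (-decayExp d p ν η) * levelConst p ν η ψ φ)) =
      ENNReal.ofReal (b ^ (-decayExp d p ν η) / (2 * |ν - η|) *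
        ProbabilityTheory.beta (decayExp d p ν η + 1) (conjExp p) * (intI p ν η ψ φ).toReal) := by
    rw [← ENNReal.ofReal_natCast, ← ENNReal.ofReal_mul hn'.le]
    congr 1
    unfold levelConst
    rw [qExp_mul_gam_mul_recip hp hγ, beta_add_one_left hx hy, beta_comm (decayExp d p ν η)]
    change _ * (_ * (_ * (_ * (ProbabilityTheory.beta _ (decayExp d p ν η) / _) * _))) = _
    have e : decayExp d p ν η / (decayExp d p ν η + conjExp p) = 1 - gam d p ν η := by
      rw [div_eq_iff (by positivity)]
      linarith [gam_mul_decayExp hp hγ]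
    have := hγ.1.ne'
    rw [e]
    field_simp
  exact (ENNReal.mul_right_inj hn0 (ENNReal.natCast_ne_top n)).1 (hsum.trans hres.symm)

end level

/-! ### Plancherel for tempered distributions -/

section fourier

variable {d : ℕ}

/-- Makes the representing functions in `distNorm` and `fourierFun` unique. -/
theorem toTemperedDistribution_injective {q : ℝ≥0∞} [Fact (1 ≤ q)] :
    Function.Injective fun f : Lp ℂ q (volume : Measure (Rd d)) => (f : 𝓢'(Rd d, ℂ)) := by
  have h := Lp.ker_toTemperedDistributionCLM_eq_bot (E := Rd d) (F := ℂ) (p := q)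
    (μ := (volume : Measure (Rd d)))
  exact LinearMap.ker_eq_bot.1 h

theorem distNorm_coe {q : ℝ≥0∞} [Fact (1 ≤ q)] (f : Lp ℂ q (volume : Measure (Rd d))) :
    distNorm q (f : 𝓢'(Rd d, ℂ)) = ‖f‖ₑ := by
  unfold distNorm
  refine le_antisymm (iInf_le_of_le f (iInf_le_of_le rfl le_rfl)) (le_iInf₂ fun g hg => ?_)
  rw [toTemperedDistribution_injective hg]

theorem coe_sub {q : ℝ≥0∞} [Fact (1 ≤ q)] (f g : Lp ℂ q (volume : Measure (Rd d))) :
    ((f - g : Lp ℂ q (volume : Measure (Rd d))) : 𝓢'(Rd d, ℂ)) =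
      (f : 𝓢'(Rd d, ℂ)) - (g : 𝓢'(Rd d, ℂ)) :=
  map_sub (Lp.toTemperedDistributionCLM ℂ (volume : Measure (Rd d)) q) f g

theorem tempFourier_tempFourierInv (T : 𝓢'(Rd d, ℂ)) : tempFourier d (tempFourierInv d T) = T := by
  ext f
  change T (schwartzFourierInv d (schwartzFourier d f)) = T f
  congr 1
  unfold schwartzFourierInv schwartzFourier
  simp only [ContinuousLinearMap.comp_apply]
  have : ∀ g : 𝓢(Rd d, ℂ), SchwartzMap.compCLMOfContinuousLinearEquiv ℂ
      (dilation d (2 * Real.pi) two_pi_ne_zero)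
      (SchwartzMap.compCLMOfContinuousLinearEquiv ℂ
        (dilation d (2 * Real.pi)⁻¹ (inv_ne_zero two_pi_ne_zero)) g) = g := by
    intro g
    ext t
    simp only [SchwartzMap.compCLMOfContinuousLinearEquiv_apply, Function.comp_apply,
      dilation_apply, smul_smul, inv_mul_cancel₀ two_pi_ne_zero, one_smul]
  rw [this]
  simp

theorem eLpNorm_two_sq (f : Rd d → ℂ) :
    eLpNorm f 2 (volume : Measure (Rd d)) ^ 2 = ∫⁻ t, ‖f t‖ₑ ^ 2 := by
  have := eLpNorm_nnreal_pow_eq_lintegral (f := f) (p := 2) (μ := (volume : Measure (Rd d)))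
    two_ne_zero
  simpa using this

theorem enorm_lp_two_sq (u : Lp ℂ 2 (volume : Measure (Rd d))) :
    ‖u‖ₑ ^ 2 = ∫⁻ t, ‖u t‖ₑ ^ 2 := by
  rw [Lp.enorm_def, eLpNorm_two_sq]

theorem exists_lp_tempFourierInv (u : Lp ℂ 2 (volume : Measure (Rd d))) :
    ∃ v : Lp ℂ 2 (volume : Measure (Rd d)), (v : 𝓢'(Rd d, ℂ)) = tempFourierInv d u ∧
      ‖v‖ₑ ^ 2 = ENNReal.ofReal ((2 * Real.pi) ^ (-(d : ℝ))) * ‖u‖ₑ ^ 2 := by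
  set w : Lp ℂ 2 (volume : Measure (Rd d)) := 𝓕⁻ u with hw
  have hwu : ‖w‖ = ‖u‖ := by
    have := Lp.norm_fourier_eq w
    rw [hw, FourierTransform.fourier_fourierInv_eq] at this
    exact this.symm
  have hwu' : ‖w‖ₑ = ‖u‖ₑ := by
    rw [← ofReal_norm, hwu, ofReal_norm]
  have hpi := Real.two_pi_pos
  set c : ℝ := (2 * Real.pi)⁻¹ with hc
  have hc0 : c ≠ 0 := inv_ne_zero hpi.ne'
  have hmap : Measure.map (c • ·) (volume : Measure (Rd d)) =
      ENNReal.ofReal ((2 * Real.pi) ^ d) • (volume : Measure (Rd d)) := by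
    rw [Measure.map_addHaar_smul _ hc0, finrank_euclideanSpace_fin, hc, inv_pow, inv_inv,
      abs_of_pos (by positivity)]
  have hemb : MeasurableEmbedding (fun t : Rd d => c • t) :=
    (Homeomorph.smulOfNeZero c hc0).measurableEmbedding
  have hmp : MemLp (fun t : Rd d => w (c • t)) 2 volume := by
    have h1 : MemLp w 2 (Measure.map (c • ·) (volume : Measure (Rd d))) := by
      rw [hmap]
      exact (Lp.memLp w).smul_measure ENNReal.ofReal_ne_top
    exact (hemb.memLp_map_measure_iff).1 h1
  -- The preimage is $v(t)=(2\pi)^{-d}w(t/2\pi)$. Its squared norm carries $(2\pi)^{-2d}$ from the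
  -- factor and $(2\pi)^d$ from the dilation.
  set κ : ℂ := (((2 * Real.pi) ^ (-(d : ℝ)) : ℝ) : ℂ) with hκ
  have hmp' : MemLp (fun t : Rd d => κ * w (c • t)) 2 volume := hmp.const_mul κ
  refine ⟨hmp'.toLp _, ?_, ?_⟩
  · ext f
    rw [Lp.toTemperedDistribution_apply]
    have h1 : tempFourierInv d (u : 𝓢'(Rd d, ℂ)) f = (𝓕⁻ (u : 𝓢'(Rd d, ℂ)))
        (SchwartzMap.compCLMOfContinuousLinearEquiv ℂ (dilation d (2 * Real.pi) two_pi_ne_zero) f) :=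
      rfl
    rw [h1, Lp.fourierInv_toTemperedDistribution_eq, Lp.toTemperedDistribution_apply, ← hw]
    have h2 := Measure.integral_comp_smul (volume : Measure (Rd d))
      (fun t => f t • w (c • t)) (2 * Real.pi)
    rw [finrank_euclideanSpace_fin, abs_of_pos (by positivity)] at h2
    have h3 : ∀ t : Rd d, f ((2 * Real.pi) • t) • w (c • (2 * Real.pi) • t) =
        (SchwartzMap.compCLMOfContinuousLinearEquiv ℂ
          (dilation d (2 * Real.pi) two_pi_ne_zero) f) t • w t := fun t => by
      rw [smul_smul c, hc, inv_mul_cancel₀ hpi.ne', one_smul]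
      rfl
    simp_rw [h3] at h2
    rw [h2]
    have h4 : ∫ t, f t • (hmp'.toLp _ : Lp ℂ 2 (volume : Measure (Rd d))) t =
        ∫ t, κ * (f t • w (c • t)) := by
      refine integral_congr_ae ?_
      filter_upwards [hmp'.coeFn_toLp] with t ht
      rw [ht]
      simp only [smul_eq_mul]
      ring
    rw [h4, integral_const_mul, hκ, Real.rpow_neg hpi.le, Real.rpow_natCast]
    exact (Complex.real_smul).symm
  · rw [Lp.enorm_def, eLpNorm_congr_ae hmp'.coeFn_toLp, eLpNorm_two_sq]
    simp_rw [enorm_mul, mul_pow]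
    rw [lintegral_const_mul' _ _ (by simp)]
    have h5 : ∫⁻ t : Rd d, ‖w (c • t)‖ₑ ^ 2 =
        ENNReal.ofReal ((2 * Real.pi) ^ d) * ∫⁻ t : Rd d, ‖w t‖ₑ ^ 2 := by
      rw [← hemb.lintegral_map (fun t => ‖w t‖ₑ ^ 2), hmap, lintegral_smul_measure, smul_eq_mul]
    rw [h5, ← enorm_lp_two_sq, hwu', ← mul_assoc]
    congr 1
    have h6 : ‖κ‖ₑ = ENNReal.ofReal ((2 * Real.pi) ^ (-(d : ℝ))) := by
      rw [hκ, ← ofReal_norm, Complex.norm_real, Real.norm_of_nonneg (by positivity)]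
    rw [h6, sq, mul_assoc, ← ENNReal.ofReal_mul (by positivity)]
    have h7 : (2 * Real.pi) ^ (-(d : ℝ)) * (2 * Real.pi) ^ d = 1 := by
      rw [Real.rpow_neg hpi.le, Real.rpow_natCast, inv_mul_cancel₀ (by positivity)]
    rw [h7]
    simp

theorem l2Dist_of_memLp {f : Rd d → ℂ} (hf : MemLp f 2 (volume : Measure (Rd d))) :
    l2Dist f = ((hf.toLp f : Lp ℂ 2 volume) : 𝓢'(Rd d, ℂ)) := by
  rw [l2Dist, dif_pos hf]

/-- Plancherel's identity for `F⁻¹` on `L_2`. -/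
theorem distNorm_tempFourierInv_l2Dist {f : Rd d → ℂ}
    (hf : MemLp f 2 (volume : Measure (Rd d))) :
    distNorm 2 (tempFourierInv d (l2Dist f)) ^ 2 =
      ENNReal.ofReal ((2 * Real.pi) ^ (-(d : ℝ))) * ∫⁻ t, ‖f t‖ₑ ^ 2 := by
  obtain ⟨v, hv, hvn⟩ := exists_lp_tempFourierInv (hf.toLp f)
  rw [l2Dist_of_memLp hf, ← hv, distNorm_coe, hvn, Lp.enorm_def,
    eLpNorm_congr_ae hf.coeFn_toLp, eLpNorm_two_sq]

theorem fourierFun_ae_eq {p : ℝ≥0∞} [Fact (1 ≤ p)] {x : 𝓢'(Rd d, ℂ)}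
    {g : Lp ℂ p (volume : Measure (Rd d))} (hg : (g : 𝓢'(Rd d, ℂ)) = tempFourier d x) :
    fourierFun p x =ᵐ[volume] g := by
  have h : ∃ g : Lp ℂ p (volume : Measure (Rd d)), (g : 𝓢'(Rd d, ℂ)) = tempFourier d x := ⟨g, hg⟩
  rw [fourierFun, dif_pos h, toTemperedDistribution_injective
    (show ((Classical.choose h : Lp ℂ p volume) : 𝓢'(Rd d, ℂ)) = g from
      (Classical.choose_spec h).trans hg.symm)]

theorem l2Dist_sub {f g : Rd d → ℂ} (hf : MemLp f 2 (volume : Measure (Rd d)))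
    (hg : MemLp g 2 (volume : Measure (Rd d))) : l2Dist f - l2Dist g = l2Dist (f - g) := by
  rw [l2Dist_of_memLp hf, l2Dist_of_memLp hg, l2Dist_of_memLp (hf.sub hg), ← coe_sub,
    MemLp.toLp_sub]

end fourier

/-- Hölder's inequality with the exponents `(p/2)'` and `p/2`. -/
theorem lintegral_mul_enorm_sq_le {d : ℕ} {p : ℝ≥0∞} (hp : 2 < p) {K : Rd d → ℝ}
    (hKm : AEMeasurable K) (hK0 : ∀ t, 0 ≤ K t) {M : ℝ} (hM : 0 ≤ M)
    (hint : ∫⁻ t, ENNReal.ofReal (K t ^ conjExp p) = ENNReal.ofReal M)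
    {z : Rd d → ℂ} (hz : AEStronglyMeasurable z volume) :
    ∫⁻ t, ENNReal.ofReal (K t) * ‖z t‖ₑ ^ 2 ≤
      ENNReal.ofReal (M ^ (2 * (1 / 2 - recip p))) * eLpNorm z p volume ^ 2 := by
  have hh := half_sub_recip_pos hp
  obtain ⟨h, hh'⟩ : ∃ h, h = 1 / 2 - recip p := ⟨_, rfl⟩
  rw [← hh'] at hh ⊢
  have hy : conjExp p = 1 / (2 * h) := by rw [conjExp, ← hh']
  -- Hölder is applied to $\sqrt K\cdot z$ with $1/s+1/p=1/2$, which includes $p=\infty$. Since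
  -- $s=2(p/2)'$, the $s$-norm of $\sqrt K$ is governed by $\int K^{(p/2)'}$.
  set s : ℝ≥0∞ := ENNReal.ofReal (1 / h) with hs
  have hs0 : s ≠ 0 := by simp [hs, hh]
  have hs_fin : s ≠ ∞ := ENNReal.ofReal_ne_top
  have hsr : s.toReal = 1 / h := ENNReal.toReal_ofReal (by positivity)
  have hpinv : p⁻¹ ≠ ∞ := by
    rw [ne_eq, ENNReal.inv_eq_top]
    rintro rfl
    simp at hp
  have : ENNReal.HolderTriple s p 2 := by
    refine ⟨?_⟩
    rw [hs, ← ENNReal.ofReal_inv_of_pos (by positivity), ← ENNReal.ofReal_toReal hpinv,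
      ← ENNReal.ofReal_add (by positivity) ENNReal.toReal_nonneg]
    change ENNReal.ofReal (_ + recip p) = _
    have : (1 / h)⁻¹ + recip p = 2⁻¹ := by
      rw [one_div, inv_inv, hh']; ring
    rw [this, ENNReal.ofReal_inv_of_pos two_pos]
    simp
  set k : Rd d → ℝ := fun t => √(K t) with hk
  have hkm : AEStronglyMeasurable k volume := hKm.sqrt.aestronglyMeasurable
  have key := eLpNorm_smul_le_mul_eLpNorm (p := s) (q := p) (r := 2) hz hkm
  have hsq : ∀ t, ‖k t‖ₑ ^ 2 = ENNReal.ofReal (K t) := fun t => by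
    rw [← ofReal_norm, ← ENNReal.ofReal_pow (norm_nonneg _), Real.norm_eq_abs, sq_abs, hk,
      Real.sq_sqrt (hK0 t)]
  have e1 : ∫⁻ t, ENNReal.ofReal (K t) * ‖z t‖ₑ ^ 2 = eLpNorm (k • z) 2 volume ^ 2 := by
    rw [eLpNorm_two_sq]
    refine lintegral_congr fun t => ?_
    rw [Pi.smul_apply', enorm_smul, mul_pow, hsq]
  have e2 : eLpNorm k s volume ^ 2 = ENNReal.ofReal (M ^ (2 * h)) := by
    rw [eLpNorm_eq_lintegral_rpow_enorm_toReal hs0 hs_fin, hsr]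
    have : ∀ t, ‖k t‖ₑ ^ (1 / h) = ENNReal.ofReal (K t ^ conjExp p) := fun t => by
      rw [← ENNReal.ofReal_rpow_of_nonneg (hK0 t) (by rw [hy]; positivity), ← hsq t,
        ← ENNReal.rpow_natCast, ← ENNReal.rpow_mul, hy]
      congr 1
      push_cast
      field_simp
    simp_rw [this]
    rw [hint, one_div_one_div, ← ENNReal.rpow_natCast, ← ENNReal.rpow_mul,
      ENNReal.ofReal_rpow_of_nonneg hM (by positivity), mul_comm h]
    norm_num
  calc _ = eLpNorm (k • z) 2 volume ^ 2 := e1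
    _ ≤ (eLpNorm k s volume * eLpNorm z p volume) ^ 2 := by gcongr
    _ = _ := by rw [mul_pow, e2]

/-! ### Identities for the constants -/

section constants

variable {d n : ℕ} {p : ℝ≥0∞} {ν η : ℝ} {ψ : Rd d → ℂ} {φ : Fin n → Rd d → ℂ}

theorem intI_toReal_pos (hA : 0 < levelConst p ν η ψ φ) : 0 < (intI p ν η ψ φ).toReal := by
  refine lt_of_le_of_ne ENNReal.toReal_nonneg fun h => ?_
  rw [levelConst, ← h, mul_zero] at hA
  exact lt_irrefl _ hA

theorem constC_pos (hn : 0 < n) (hp : 2 < p) (hγ : gam d p ν η ∈ Ioo (0 : ℝ) 1) :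
    0 < constC d n p ν η := by
  have hn' : (0 : ℝ) < n := by exact_mod_cast hn
  have h0 := hγ.1
  have h1 := sub_pos.2 hγ.2
  have hk := abs_pos.2 (sub_ne_zero_of_gam hγ)
  have hB : 0 < ProbabilityTheory.beta (qExp d p ν η * gam d p ν η * recip p + 1)
      (qExp d p ν η * (1 - gam d p ν η) / 2) := by
    rw [qExp_mul_gam_mul_recip hp hγ]
    exact ProbabilityTheory.beta_pos (conjExp_pos hp) (decayExp_pos hp hγ)
  unfold constC
  positivity

theorem betaConst_pos (hn : 0 < n) (hp : 2 < p) (hγ : gam d p ν η ∈ Ioo (0 : ℝ) 1)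
    (hA : 0 < levelConst p ν η ψ φ) {δ : ℝ} (hδ : 0 < δ) : 0 < betaConst p ν η ψ φ δ := by
  have hn' : (0 : ℝ) < n := by exact_mod_cast hn
  have h1 := sub_pos.2 hγ.2
  have hC := constC_pos hn hp hγ
  have hI := intI_toReal_pos hA
  have hpi := Real.two_pi_pos
  unfold betaConst
  positivity

theorem sharpConst_pos (hn : 0 < n) (hp : 2 < p) (hγ : gam d p ν η ∈ Ioo (0 : ℝ) 1)
    (hA : 0 < levelConst p ν η ψ φ) : 0 < sharpConst p ν η ψ φ := by
  have hC := constC_pos hn hp hγ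
  have hI := intI_toReal_pos hA
  have hpi := Real.two_pi_pos
  unfold sharpConst
  positivity

/-- All constants are products of real powers of positive numbers; after taking logarithms the
identities among them become linear. -/
theorem log_constC (hn : 0 < n) (hp : 2 < p) (hγ : gam d p ν η ∈ Ioo (0 : ℝ) 1) :
    Real.log (constC d n p ν η) = -(gam d p ν η * recip p) * Real.log (gam d p ν η) -
      (1 - gam d p ν η) / 2 * (Real.log (1 - gam d p ν η) - Real.log n) +
      gam d p ν η * (1 / 2 - recip p) *
        Real.log (ProbabilityTheory.beta (qExp d p ν η * gam d p ν η * recip p + 1)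
          (qExp d p ν η * (1 - gam d p ν η) / 2) / (2 * |ν - η|)) := by
  have hn' : (0 : ℝ) < n := by exact_mod_cast hn
  have h0 := hγ.1
  have h1 := sub_pos.2 hγ.2
  have hk := abs_pos.2 (sub_ne_zero_of_gam hγ)
  have hB : 0 < ProbabilityTheory.beta (qExp d p ν η * gam d p ν η * recip p + 1)
      (qExp d p ν η * (1 - gam d p ν η) / 2) := by
    rw [qExp_mul_gam_mul_recip hp hγ]
    exact ProbabilityTheory.beta_pos (conjExp_pos hp) (decayExp_pos hp hγ)
  have hq : 1 / qExp d p ν η = gam d p ν η * (1 / 2 - recip p) := by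
    rw [qExp, one_div_one_div]
  unfold constC
  rw [Real.log_mul (by positivity) (by positivity), Real.log_mul (by positivity) (by positivity),
    Real.log_rpow h0, Real.log_rpow (by positivity), Real.log_rpow (by positivity),
    Real.log_div h1.ne' hn'.ne', hq]
  ring

theorem log_betaConst (hn : 0 < n) (hp : 2 < p) (hγ : gam d p ν η ∈ Ioo (0 : ℝ) 1)
    (hA : 0 < levelConst p ν η ψ φ) {δ : ℝ} (hδ : 0 < δ) :
    Real.log (betaConst p ν η ψ φ δ) = Real.log (1 - gam d p ν η) - Real.log n -
      d * gam d p ν η * Real.log (2 * Real.pi) + 2 * Real.log (constC d n p ν η) +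
      2 * gam d p ν η * (Real.log δ +
        (1 / 2 - recip p) * Real.log (intI p ν η ψ φ).toReal) := by
  have hn' : (0 : ℝ) < n := by exact_mod_cast hn
  have h1 := sub_pos.2 hγ.2
  have hC := constC_pos hn hp hγ
  have hI := intI_toReal_pos hA
  have hpi := Real.two_pi_pos
  unfold betaConst
  rw [Real.log_mul (by positivity) (by positivity), Real.log_mul (by positivity) (by positivity),
    Real.log_div h1.ne' (by positivity), Real.log_mul hn'.ne' (by positivity), Real.log_rpow hpi,
    Real.log_pow, Real.log_rpow (by positivity), Real.log_mul hδ.ne' (by positivity),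
    Real.log_rpow hI]
  push_cast
  ring

/-- The right side is $\beta n+\frac{\gamma}{1-\gamma}\beta n$, the derivative term plus the data
term in the error bound. -/
theorem sharpConst_sq (hn : 0 < n) (hp : 2 < p) (hγ : gam d p ν η ∈ Ioo (0 : ℝ) 1)
    (hA : 0 < levelConst p ν η ψ φ) {δ : ℝ} (hδ : 0 < δ) :
    (sharpConst p ν η ψ φ * δ ^ gam d p ν η) ^ 2 =
      betaConst p ν η ψ φ δ * n / (1 - gam d p ν η) := by
  have hn' : (0 : ℝ) < n := by exact_mod_cast hn
  have h1 := sub_pos.2 hγ.2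
  have hC := constC_pos hn hp hγ
  have hI := intI_toReal_pos hA
  have hpi := Real.two_pi_pos
  have hS := sharpConst_pos hn hp hγ hA
  have hb := betaConst_pos hn hp hγ hA hδ
  have hq : 1 / qExp d p ν η = gam d p ν η * (1 / 2 - recip p) := by
    rw [qExp, one_div_one_div]
  have hlS : Real.log (sharpConst p ν η ψ φ) = -(d * gam d p ν η / 2 * Real.log (2 * Real.pi)) +
      Real.log (constC d n p ν η) +
      gam d p ν η * (1 / 2 - recip p) * Real.log (intI p ν η ψ φ).toReal := by
    unfold sharpConst
    rw [Real.log_mul (by positivity) (by positivity), Real.log_mul (by positivity) (by positivity),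
      Real.log_div one_ne_zero (by positivity), Real.log_rpow hpi, Real.log_rpow hI, hq,
      Real.log_one]
    ring
  refine Real.log_injOn_pos (Set.mem_Ioi.2 (by positivity)) (Set.mem_Ioi.2 (by positivity)) ?_
  rw [Real.log_pow, Real.log_mul hS.ne' (by positivity), Real.log_rpow hδ,
    Real.log_div (by positivity) h1.ne', Real.log_mul hb.ne' hn'.ne',
    log_betaConst hn hp hγ hA hδ, hlS]
  push_cast
  ring

/-- The equation that determines $\beta$: the left side is the Hölder bound for the data term. The
same equation gives the extremal function its unit norms. -/
theorem level_identity (hn : 0 < n) (hp : 2 < p) (hγ : gam d p ν η ∈ Ioo (0 : ℝ) 1)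
    (hA : 0 < levelConst p ν η ψ φ) {δ : ℝ} (hδ : 0 < δ) :
    (2 * Real.pi) ^ (-(d : ℝ)) * δ ^ 2 * (betaConst p ν η ψ φ δ ^ (-decayExp d p ν η) *
      levelConst p ν η ψ φ) ^ (2 * (1 / 2 - recip p)) =
      gam d p ν η * n / (1 - gam d p ν η) * betaConst p ν η ψ φ δ := by
  have hn' : (0 : ℝ) < n := by exact_mod_cast hn
  have h0 := hγ.1
  have h1 := sub_pos.2 hγ.2
  have hI := intI_toReal_pos hA
  have hpi := Real.two_pi_pos
  have hb := betaConst_pos hn hp hγ hA hδ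
  have hk := abs_pos.2 (sub_ne_zero_of_gam hγ)
  have hB : 0 < ProbabilityTheory.beta (qExp d p ν η * gam d p ν η * recip p + 1)
      (qExp d p ν η * (1 - gam d p ν η) / 2) := by
    rw [qExp_mul_gam_mul_recip hp hγ]
    exact ProbabilityTheory.beta_pos (conjExp_pos hp) (decayExp_pos hp hγ)
  have hlA : Real.log (levelConst p ν η ψ φ) = Real.log (gam d p ν η) +
      Real.log (ProbabilityTheory.beta (qExp d p ν η * gam d p ν η * recip p + 1)
          (qExp d p ν η * (1 - gam d p ν η) / 2) / (2 * |ν - η|)) +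
      Real.log (intI p ν η ψ φ).toReal := by
    unfold levelConst
    rw [Real.log_mul (by positivity) hI.ne', Real.log_mul h0.ne' (by positivity)]
  have hlb := log_betaConst hn hp hγ hA hδ
  have hx : decayExp d p ν η * (2 * (1 / 2 - recip p)) =
      (1 - gam d p ν η) / gam d p ν η := by
    have h2 := (half_sub_recip_pos hp).ne'
    have h3 := gam_mul_decayExp hp hγ
    rw [eq_div_iff h0.ne']
    have h4 : conjExp p * (2 * (1 / 2 - recip p)) = 1 := by
      unfold conjExp
      generalize 1 / 2 - recip p = h at *
      field_simp
    linear_combination (2 * (1 / 2 - recip p)) * h3 + (1 - gam d p ν η) * h4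
  refine Real.log_injOn_pos (Set.mem_Ioi.2 (by positivity)) (Set.mem_Ioi.2 (by positivity)) ?_
  rw [Real.log_mul (by positivity) (by positivity), Real.log_mul (by positivity) (by positivity),
    Real.log_rpow hpi, Real.log_pow, Real.log_rpow (by positivity),
    Real.log_mul (by positivity) hA.ne', Real.log_rpow hb, Real.log_mul (by positivity) hb.ne',
    Real.log_div (by positivity) h1.ne', Real.log_mul h0.ne' hn'.ne', hlA]
  rw [log_constC hn hp hγ] at hlb
  set D := Real.log (ProbabilityTheory.beta (qExp d p ν η * gam d p ν η * recip p + 1)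
          (qExp d p ν η * (1 - gam d p ν η) / 2) / (2 * |ν - η|))
  set L := Real.log (betaConst p ν η ψ φ δ)
  have e : 2 * (1 / 2 - recip p) * (-decayExp d p ν η * L + (Real.log (gam d p ν η) + D +
      Real.log (intI p ν η ψ φ).toReal)) = -((1 - gam d p ν η) / gam d p ν η) * L +
      2 * (1 / 2 - recip p) * (Real.log (gam d p ν η) + D +
      Real.log (intI p ν η ψ φ).toReal) := by
    rw [← hx]; ring
  rw [e]
  -- On the left $\beta$ has exponent $-(1-\gamma)/\gamma=1-1/\gamma$, on the right exponent $1$;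
  -- what remains is the explicit formula for $\beta^{1/\gamma}$.
  have hLg : L / gam d p ν η = 2 * (1 / 2 - recip p) * (Real.log (gam d p ν η) + D +
      Real.log (intI p ν η ψ φ).toReal) + 2 * Real.log δ - d * Real.log (2 * Real.pi) +
      Real.log (1 - gam d p ν η) - Real.log (gam d p ν η) - Real.log n := by
    rw [div_eq_iff h0.ne', hlb]
    ring
  have : -((1 - gam d p ν η) / gam d p ν η) * L = L - L / gam d p ν η := by
    field_simp
    ring
  rw [this, hLg]
  push_cast
  ring

theorem pos_of_ae_sum_ne_zero (hφ0 : ∀ᵐ t : Rd d, ∑ j, ‖φ j t‖ ≠ 0) : 0 < n := by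
  rcases Nat.eq_zero_or_pos n with rfl | h
  · have : (ae (volume : Measure (Rd d))).NeBot := ae_neBot.2 (NeZero.ne _)
    obtain ⟨t, ht⟩ := hφ0.exists
    simp at ht
  · exact h

end constants

/-- The standing assumptions on `ψ` and `φ_1, …, φ_n`. -/
structure IsAdmissible {d n : ℕ} (p : ℝ≥0∞) (ν η : ℝ) (ψ : Rd d → ℂ) (φ : Fin n → Rd d → ℂ) :
    Prop where
  one_le_dim : 1 ≤ d
  two_lt : 2 < p
  meas_left : AEStronglyMeasurable ψ volume
  meas_right : ∀ j, AEStronglyMeasurable (φ j) volume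
  hom_left : IsAbsHomogeneous ψ η
  hom_right : ∀ j, IsAbsHomogeneous (φ j) ν
  ne_zero_left : ∀ᵐ t : Rd d, ψ t ≠ 0
  ne_zero_right : ∀ᵐ t : Rd d, ∑ j, ‖φ j t‖ ≠ 0
  gam_mem : gam d p ν η ∈ Ioo (0 : ℝ) 1
  intI_lt_top : intI p ν η ψ φ < ∞
  intI'_eq : ∀ i j, intI' p ν η ψ φ i = intI' p ν η ψ φ j

theorem enorm_sq_eq_ofReal (z : ℂ) : ‖z‖ₑ ^ 2 = ENNReal.ofReal (‖z‖ ^ 2) := by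
  rw [← ofReal_norm, ENNReal.ofReal_pow (norm_nonneg _)]

theorem memLp_two_iff {d : ℕ} {f : Rd d → ℂ} (hf : AEStronglyMeasurable f volume) :
    MemLp f 2 (volume : Measure (Rd d)) ↔ ∫⁻ t, ‖f t‖ₑ ^ 2 < ∞ := by
  rw [← eLpNorm_two_sq, MemLp, and_iff_right hf]
  simp [ENNReal.pow_lt_top_iff]

namespace IsAdmissible

variable {d n : ℕ} {p : ℝ≥0∞} {ν η : ℝ} {ψ : Rd d → ℂ} {φ : Fin n → Rd d → ℂ}

theorem card_pos (H : IsAdmissible p ν η ψ φ) : 0 < n := pos_of_ae_sum_ne_zero H.ne_zero_right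

theorem level_pos (H : IsAdmissible p ν η ψ φ) : 0 < levelConst p ν η ψ φ :=
  levelConst_pos H.one_le_dim H.two_lt H.meas_left H.meas_right H.hom_left H.hom_right
    H.ne_zero_left H.ne_zero_right H.gam_mem H.intI_lt_top

theorem beta_pos (H : IsAdmissible p ν η ψ φ) {δ : ℝ} (hδ : 0 < δ) :
    0 < betaConst p ν η ψ φ δ :=
  betaConst_pos H.card_pos H.two_lt H.gam_mem H.level_pos hδ

end IsAdmissible

/-! ### The pointwise bound and the extremal function -/

section pointwise

variable {d n : ℕ} {p : ℝ≥0∞} {ν η : ℝ} {ψ : Rd d → ℂ} {φ : Fin n → Rd d → ℂ}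

theorem aestronglyMeasurable_optFilter (H : IsAdmissible p ν η ψ φ) (δ : ℝ) :
    AEStronglyMeasurable (optFilter p ν η ψ φ δ) volume := by
  unfold optFilter
  refine AEStronglyMeasurable.mul ?_ H.meas_left
  refine Complex.continuous_ofReal.comp_aestronglyMeasurable ?_
  have h := aemeasurable_s2 H.meas_right
  have h' := H.meas_left.norm.aemeasurable
  exact ((((h.div (h'.pow_const 2)).const_mul _).const_sub 1).max
    aemeasurable_const).aestronglyMeasurable

/-- Convexity of the square with weights $1-a$ and $a$, where $a|\psi|^2=K$ and
$(1-a)|\psi|^2\le\beta s_2$. -/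
theorem norm_sq_sub_optFilter_le {δ : ℝ} (hb : 0 < betaConst p ν η ψ φ δ) {t : Rd d}
    (ht : ψ t ≠ 0) (g y : ℂ) :
    ‖ψ t * g - optFilter p ν η ψ φ δ t * y‖ ^ 2 ≤
      betaConst p ν η ψ φ δ * s2 φ t * ‖g‖ ^ 2 +
        excess ψ φ (betaConst p ν η ψ φ δ) t * ‖g - y‖ ^ 2 := by
  set b := betaConst p ν η ψ φ δ with hbdef
  set a : ℝ := max (1 - b * (s2 φ t / ‖ψ t‖ ^ 2)) 0 with ha
  have hW : 0 < ‖ψ t‖ := norm_pos_iff.2 ht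
  have hs : 0 ≤ s2 φ t := s2_nonneg t
  have ha0 : 0 ≤ a := le_max_right _ _
  have ha1 : a ≤ 1 := by
    refine max_le ?_ zero_le_one
    have : 0 ≤ b * (s2 φ t / ‖ψ t‖ ^ 2) := by positivity
    linarith
  have hK : a * ‖ψ t‖ ^ 2 = excess ψ φ b t := by
    rw [ha, excess, max_mul_of_nonneg _ _ (by positivity), zero_mul]
    congr 1
    field_simp
  have hle : (1 - a) * ‖ψ t‖ ^ 2 ≤ b * s2 φ t := by
    have : ‖ψ t‖ ^ 2 - b * s2 φ t ≤ excess ψ φ b t := le_max_left _ _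
    linarith
  have hopt : optFilter p ν η ψ φ δ t = (a : ℂ) * ψ t := rfl
  have hdecomp : ψ t * g - optFilter p ν η ψ φ δ t * y =
      ((1 - a : ℝ) : ℂ) * (ψ t * g) + (a : ℂ) * (ψ t * (g - y)) := by
    rw [hopt]; push_cast; ring
  have hn : ‖ψ t * g - optFilter p ν η ψ φ δ t * y‖ ≤
      (1 - a) * (‖ψ t‖ * ‖g‖) + a * (‖ψ t‖ * ‖g - y‖) := by
    rw [hdecomp]
    refine (norm_add_le _ _).trans (le_of_eq ?_)
    rw [norm_mul, norm_mul, norm_mul, norm_mul, Complex.norm_real, Complex.norm_real,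
      Real.norm_of_nonneg ha0, Real.norm_of_nonneg (sub_nonneg.2 ha1)]
  calc _ ≤ ((1 - a) * (‖ψ t‖ * ‖g‖) + a * (‖ψ t‖ * ‖g - y‖)) ^ 2 := by gcongr
    _ ≤ (1 - a) * ‖ψ t‖ ^ 2 * ‖g‖ ^ 2 + a * ‖ψ t‖ ^ 2 * ‖g - y‖ ^ 2 := by
      -- The gap in the convexity inequality is exactly $a(1-a)$ times the square of the difference.
      have h1 : 0 ≤ (1 - a) * a := mul_nonneg (sub_nonneg.2 ha1) ha0
      nlinarith [mul_nonneg h1 (sq_nonneg (‖ψ t‖ * ‖g‖ - ‖ψ t‖ * ‖g - y‖))]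
    _ ≤ _ := by
      rw [hK]
      gcongr

/-- The a priori bound behind the optimality of the filter. -/
theorem lintegral_sub_optFilter_le (H : IsAdmissible p ν η ψ φ) {δ : ℝ} (hδ : 0 < δ)
    {g y : Rd d → ℂ} (hg : AEStronglyMeasurable g volume) (hy : AEStronglyMeasurable y volume) :
    ∫⁻ t, ‖ψ t * g t - optFilter p ν η ψ φ δ t * y t‖ₑ ^ 2 ≤
      ENNReal.ofReal (betaConst p ν η ψ φ δ) * (∑ j, ∫⁻ t, ‖φ j t * g t‖ₑ ^ 2) +
      ENNReal.ofReal ((betaConst p ν η ψ φ δ ^ (-decayExp d p ν η) *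
        levelConst p ν η ψ φ) ^ (2 * (1 / 2 - recip p))) * eLpNorm (g - y) p volume ^ 2 := by
  have hb := H.beta_pos hδ
  set b := betaConst p ν η ψ φ δ with hbdef
  have hA := H.level_pos
  have hint := lintegral_excess H.one_le_dim H.two_lt H.meas_left H.meas_right H.hom_left
    H.hom_right H.ne_zero_right H.gam_mem H.intI_lt_top hb
  have hKm := aemeasurable_excess (b := b) H.meas_left H.meas_right
  have hhold := lintegral_mul_enorm_sq_le H.two_lt hKm excess_nonneg (by positivity) hint
    (hg.sub hy)
  have hpt : ∀ᵐ t : Rd d, ‖ψ t * g t - optFilter p ν η ψ φ δ t * y t‖ₑ ^ 2 ≤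
      ENNReal.ofReal b * ∑ j, ‖φ j t * g t‖ₑ ^ 2 +
        ENNReal.ofReal (excess ψ φ b t) * ‖(g - y) t‖ₑ ^ 2 := by
    filter_upwards [H.ne_zero_left] with t ht
    have h := norm_sq_sub_optFilter_le hb ht (g t) (y t)
    have hK := excess_nonneg (ψ := ψ) (φ := φ) (b := b) t
    simp_rw [enorm_sq_eq_ofReal]
    rw [← ENNReal.ofReal_sum_of_nonneg fun i _ => by positivity, ← ENNReal.ofReal_mul hb.le,
      ← ENNReal.ofReal_mul hK, ← ENNReal.ofReal_add (by positivity) (by positivity)]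
    refine ENNReal.ofReal_le_ofReal (h.trans (le_of_eq ?_))
    simp only [norm_mul, mul_pow, ← Finset.sum_mul, Pi.sub_apply]
    rw [← mul_assoc]
    rfl
  have hm : ∀ j, AEMeasurable (fun t => ‖φ j t * g t‖ₑ ^ 2) := fun j =>
    ((H.meas_right j).mul hg).enorm.pow_const 2
  calc _ ≤ ∫⁻ t, (ENNReal.ofReal b * ∑ j, ‖φ j t * g t‖ₑ ^ 2 +
        ENNReal.ofReal (excess ψ φ b t) * ‖(g - y) t‖ₑ ^ 2) := lintegral_mono_ae hpt
    _ = ENNReal.ofReal b * (∑ j, ∫⁻ t, ‖φ j t * g t‖ₑ ^ 2) +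
        ∫⁻ t, ENNReal.ofReal (excess ψ φ b t) * ‖(g - y) t‖ₑ ^ 2 := by
      rw [lintegral_add_left' ((Finset.aemeasurable_fun_sum _ fun j _ => hm j).const_mul _),
        lintegral_const_mul' _ _ ENNReal.ofReal_ne_top, lintegral_finsetSum' _ fun j _ => hm j]
    _ ≤ _ := by gcongr

/-- On the support of $K$ one has $w^2=K+bs$. The quotient $K^y/K$ replaces $K^{y-1}$ because it is
$0$ at $K=0$ even for $y=1$, the case $p=\infty$. -/
theorem weight_mul_rpow_div {K w y : ℝ} (hy : 0 < y) (b s : ℝ) (hK : K = max (w ^ 2 - b * s) 0) :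
    w ^ 2 * (K ^ y / K) = K ^ y + b * s * (K ^ y / K) := by
  rcases le_or_gt (w ^ 2 - b * s) 0 with h | h
  · rw [max_eq_right h] at hK
    rw [hK, Real.zero_rpow hy.ne']
    simp
  · rw [max_eq_left h.le] at hK
    have h0 : K ≠ 0 := by rw [hK]; exact h.ne'
    have : w ^ 2 = K + b * s := by linarith
    rw [this]
    field_simp

/-- The extremal function. -/
def extremalFun (p : ℝ≥0∞) (ψ : Rd d → ℂ) (φ : Fin n → Rd d → ℂ) (b κ : ℝ) (t : Rd d) : ℂ :=
  ((κ * √(excess ψ φ b t ^ conjExp p / excess ψ φ b t) : ℝ) : ℂ)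

theorem norm_sq_extremalFun (b κ : ℝ) (t : Rd d) :
    ‖extremalFun p ψ φ b κ t‖ ^ 2 =
      κ ^ 2 * (excess ψ φ b t ^ conjExp p / excess ψ φ b t) := by
  have h0 := excess_nonneg (ψ := ψ) (φ := φ) (b := b) t
  rw [extremalFun, Complex.norm_real, Real.norm_eq_abs, sq_abs, mul_pow,
    Real.sq_sqrt (by positivity)]

theorem aestronglyMeasurable_extremalFun (H : IsAdmissible p ν η ψ φ) (b κ : ℝ) :
    AEStronglyMeasurable (extremalFun p ψ φ b κ) volume := by
  have := aemeasurable_excess (b := b) H.meas_left H.meas_right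
  exact Complex.continuous_ofReal.comp_aestronglyMeasurable
    ((((this.pow_const _).div this).sqrt).const_mul κ).aestronglyMeasurable

/-- For finite $p$, $((p/2)'-1)\,p/2=(p/2)'$, so the $p$-th power of the function is
$\kappa^pK^{(p/2)'}$. For $p=\infty$ it is $\kappa$ times the indicator of $\{K>0\}$. -/
theorem eLpNorm_extremalFun_le (hp : 2 < p) {b κ M : ℝ} (hκ : 0 ≤ κ) (hM : 0 < M)
    (hint : ∫⁻ t, ENNReal.ofReal (excess ψ φ b t ^ conjExp p) = ENNReal.ofReal M) :
    eLpNorm (extremalFun p ψ φ b κ) p volume ≤ ENNReal.ofReal (κ * M ^ recip p) := by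
  have hn : ∀ t, ‖extremalFun p ψ φ b κ t‖ =
      κ * √(excess ψ φ b t ^ conjExp p / excess ψ φ b t) := fun t => by
    rw [extremalFun, Complex.norm_real, Real.norm_of_nonneg (by positivity)]
  have hy := conjExp_pos hp
  rcases eq_or_ne p ∞ with rfl | hpt
  · have hr : recip ∞ = 0 := by simp [recip]
    have hy1 : conjExp ∞ = 1 := by rw [conjExp, hr]; norm_num
    rw [hr, Real.rpow_zero, mul_one, eLpNorm_exponent_top]
    refine eLpNormEssSup_le_of_ae_bound (Filter.Eventually.of_forall fun t => ?_)
    rw [hn, hy1, Real.rpow_one]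
    refine mul_le_of_le_one_right hκ ?_
    exact Real.sqrt_le_one.2 (div_self_le_one _)
  · have hp0 : p ≠ 0 := by rintro rfl; simp at hp
    have hpr : 0 < p.toReal := ENNReal.toReal_pos hp0 hpt
    have hrec : recip p = 1 / p.toReal := by rw [recip, ENNReal.toReal_inv, one_div]
    have hr : 0 < recip p := by rw [hrec]; positivity
    have hh := half_sub_recip_pos hp
    have hexp : (conjExp p - 1) * (p.toReal / 2) = conjExp p := by
      have h1 : p.toReal = 1 / recip p := by rw [hrec, one_div_one_div]
      have h2 : conjExp p * (2 * (1 / 2 - recip p)) = 1 :=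
        one_div_mul_cancel (by positivity)
      have h3 : conjExp p - 1 = 2 * recip p * conjExp p := by linarith
      have h4 := hr.ne'
      rw [h3, h1]
      field_simp
    rw [eLpNorm_eq_lintegral_rpow_enorm_toReal hp0 hpt]
    have e : ∀ t, ‖extremalFun p ψ φ b κ t‖ₑ ^ p.toReal =
        ENNReal.ofReal (κ ^ p.toReal) * ENNReal.ofReal (excess ψ φ b t ^ conjExp p) := fun t => by
      have h0 := excess_nonneg (ψ := ψ) (φ := φ) (b := b) t
      rw [← ofReal_norm, ENNReal.ofReal_rpow_of_nonneg (norm_nonneg _) hpr.le,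
        ← ENNReal.ofReal_mul (by positivity), hn, Real.mul_rpow hκ (by positivity)]
      congr 2
      rw [Real.sqrt_eq_rpow, ← Real.rpow_mul (by positivity)]
      rcases h0.eq_or_lt with h | h
      · rw [← h, Real.zero_rpow hy.ne', zero_div, Real.zero_rpow (by positivity)]
      · rw [← Real.rpow_sub_one h.ne', ← Real.rpow_mul h.le]
        congr 1
        refine Eq.trans ?_ hexp
        ring
    simp_rw [e]
    rw [lintegral_const_mul' _ _ ENNReal.ofReal_ne_top, hint, ← ENNReal.ofReal_mul (by positivity),
      ENNReal.ofReal_rpow_of_nonneg (by positivity) (by positivity),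
      Real.mul_rpow (by positivity) hM.le, ← Real.rpow_mul hκ, mul_one_div_cancel hpr.ne',
      Real.rpow_one, hrec]

/-- A function at which the upper bound is attained. -/
theorem exists_extremal (H : IsAdmissible p ν η ψ φ) {δ : ℝ} (hδ : 0 < δ) :
    ∃ u : Rd d → ℂ, AEStronglyMeasurable u volume ∧
      eLpNorm u p volume ≤ ENNReal.ofReal δ ∧
      (∀ j, ENNReal.ofReal ((2 * Real.pi) ^ (-(d : ℝ))) * ∫⁻ t, ‖φ j t * u t‖ₑ ^ 2 = 1) ∧
      ENNReal.ofReal ((2 * Real.pi) ^ (-(d : ℝ))) * ∫⁻ t, ‖ψ t * u t‖ₑ ^ 2 =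
        ENNReal.ofReal ((sharpConst p ν η ψ φ * δ ^ gam d p ν η) ^ 2) := by
  have hb := H.beta_pos hδ
  have hA := H.level_pos
  have hn : (0 : ℝ) < n := by exact_mod_cast H.card_pos
  have h0 := H.gam_mem.1
  have h1 := sub_pos.2 H.gam_mem.2
  have hsq := sharpConst_sq H.card_pos H.two_lt H.gam_mem hA hδ
  have hlev := level_identity H.card_pos H.two_lt H.gam_mem hA hδ
  have hpi : 0 < (2 * Real.pi) ^ (-(d : ℝ)) := Real.rpow_pos_of_pos Real.two_pi_pos _
  have hint := lintegral_excess H.one_le_dim H.two_lt H.meas_left H.meas_right H.hom_left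
    H.hom_right H.ne_zero_right H.gam_mem H.intI_lt_top hb
  have hintj := lintegral_mul_excess H.one_le_dim H.two_lt H.meas_left H.meas_right H.hom_left
    H.hom_right H.ne_zero_right H.gam_mem H.intI_lt_top H.intI'_eq hb
  set b := betaConst p ν η ψ φ δ with hbdef
  set M := b ^ (-decayExp d p ν η) * levelConst p ν η ψ φ with hMdef
  have hM : 0 < M := by positivity
  -- Chosen so that the bound $\kappa M^{1/p}$ on the $L_p$-norm equals $\delta$.
  set κ := δ * M ^ (-recip p) with hκ
  have hκ0 : 0 < κ := by positivity
  have hy := conjExp_pos H.two_lt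
  have hκ2 : κ ^ 2 * M = δ ^ 2 * M ^ (2 * (1 / 2 - recip p)) := by
    rw [hκ, mul_pow, mul_assoc, ← Real.rpow_mul_natCast hM.le, ← Real.rpow_add_one hM.ne']
    congr 2
    push_cast
    ring
  have hκ3 : (2 * Real.pi) ^ (-(d : ℝ)) * (κ ^ 2 * M) =
      gam d p ν η * n / (1 - gam d p ν η) * b := by
    rw [hκ2, ← hlev]; ring
  refine ⟨extremalFun p ψ φ b κ, aestronglyMeasurable_extremalFun H b κ, ?_, fun j => ?_, ?_⟩
  · refine (eLpNorm_extremalFun_le H.two_lt hκ0.le hM hint).trans (le_of_eq ?_)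
    rw [hκ, mul_assoc, ← Real.rpow_add hM, neg_add_cancel, Real.rpow_zero, mul_one]
  · have e : ∀ t, ‖φ j t * extremalFun p ψ φ b κ t‖ₑ ^ 2 = ENNReal.ofReal (κ ^ 2 / b) *
        ENNReal.ofReal (b * ‖φ j t‖ ^ 2 * (excess ψ φ b t ^ conjExp p / excess ψ φ b t)) := by
      intro t
      rw [enorm_sq_eq_ofReal, norm_mul, mul_pow, norm_sq_extremalFun,
        ← ENNReal.ofReal_mul (by positivity)]
      congr 1
      field_simp
    simp_rw [e]
    rw [lintegral_const_mul' _ _ ENNReal.ofReal_ne_top, hintj j,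
      ← ENNReal.ofReal_mul (by positivity), ← ENNReal.ofReal_mul hpi.le, ENNReal.ofReal_eq_one]
    have : (2 * Real.pi) ^ (-(d : ℝ)) * (κ ^ 2 / b *
        ((1 - gam d p ν η) / (gam d p ν η * n) * M)) =
        (2 * Real.pi) ^ (-(d : ℝ)) * (κ ^ 2 * M) * (1 - gam d p ν η) / (gam d p ν η * n * b) := by
      field_simp
    rw [this, hκ3]
    field_simp
  · have hm := aemeasurable_excess (b := b) H.meas_left H.meas_right
    -- Splits $|\psi u|^2$ into the part carried by $K$ and the parts carried by the $\varphi_j$,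
    -- whose integrals are known; they add up to $M/\gamma$.
    have e : ∀ t, ‖ψ t * extremalFun p ψ φ b κ t‖ₑ ^ 2 = ENNReal.ofReal (κ ^ 2) *
        (ENNReal.ofReal (excess ψ φ b t ^ conjExp p) + ∑ j,
        ENNReal.ofReal (b * ‖φ j t‖ ^ 2 * (excess ψ φ b t ^ conjExp p / excess ψ φ b t))) := by
      intro t
      have hK0 := excess_nonneg (ψ := ψ) (φ := φ) (b := b) t
      rw [enorm_sq_eq_ofReal, norm_mul, mul_pow, norm_sq_extremalFun,
        ← ENNReal.ofReal_sum_of_nonneg fun i _ => by positivity,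
        ← ENNReal.ofReal_add (by positivity) (Finset.sum_nonneg fun i _ => by positivity),
        ← ENNReal.ofReal_mul (by positivity), ← Finset.sum_mul, ← Finset.mul_sum]
      congr 1
      rw [mul_left_comm, weight_mul_rpow_div (K := excess ψ φ b t) hy b (s2 φ t) rfl]
      rfl
    have hmj : ∀ j, AEMeasurable fun t =>
        ENNReal.ofReal (b * ‖φ j t‖ ^ 2 * (excess ψ φ b t ^ conjExp p / excess ψ φ b t)) :=
      fun j => (((((H.meas_right j).norm.aemeasurable.pow_const 2).const_mul b).mul
        ((hm.pow_const _).div hm))).ennreal_ofReal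
    simp_rw [e]
    rw [lintegral_const_mul' _ _ ENNReal.ofReal_ne_top,
      lintegral_add_left' (hm.pow_const _).ennreal_ofReal,
      lintegral_finsetSum' _ fun j _ => hmj j, hint, Finset.sum_congr rfl fun j _ => hintj j,
      Finset.sum_const, Finset.card_univ, Fintype.card_fin, nsmul_eq_mul,
      ← ENNReal.ofReal_natCast, ← ENNReal.ofReal_mul hn.le,
      ← ENNReal.ofReal_add hM.le (by positivity), ← ENNReal.ofReal_mul (by positivity),
      ← ENNReal.ofReal_mul hpi.le, hsq]
    congr 1
    have : (2 * Real.pi) ^ (-(d : ℝ)) * (κ ^ 2 *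
        (M + n * ((1 - gam d p ν η) / (gam d p ν η * n) * M))) =
        (2 * Real.pi) ^ (-(d : ℝ)) * (κ ^ 2 * M) / gam d p ν η := by
      field_simp
      ring
    rw [this, hκ3]
    field_simp

end pointwise

/-! ### Optimal recovery and the sharp inequality -/

section recovery

variable {d n : ℕ} {p : ℝ≥0∞} {ν η : ℝ} {ψ : Rd d → ℂ} {φ : Fin n → Rd d → ℂ}

theorem enorm_le_of_sq_le_sq {a b : ℝ≥0∞} (h : a ^ 2 ≤ b ^ 2) : a ≤ b :=
  (ENNReal.pow_le_pow_left_iff two_ne_zero).1 h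

theorem memLp_sub_optFilter (H : IsAdmissible p ν η ψ φ) {δ : ℝ} (hδ : 0 < δ) {g y : Rd d → ℂ}
    (hg : MemLp g p volume) (hy : MemLp y p volume)
    (hφg : ∀ j, MemLp (fun t => φ j t * g t) 2 volume) :
    MemLp (fun t => ψ t * g t - optFilter p ν η ψ φ δ t * y t) 2 volume := by
  have hm : AEStronglyMeasurable (fun t => ψ t * g t - optFilter p ν η ψ φ δ t * y t) volume :=
    (H.meas_left.mul hg.1).sub ((aestronglyMeasurable_optFilter H δ).mul hy.1)
  refine (memLp_two_iff hm).2 ((lintegral_sub_optFilter_le H hδ hg.1 hy.1).trans_lt ?_)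
  refine ENNReal.add_lt_top.2 ⟨ENNReal.mul_lt_top ENNReal.ofReal_lt_top ?_,
    ENNReal.mul_lt_top ENNReal.ofReal_lt_top (ENNReal.pow_lt_top (hg.sub hy).2)⟩
  exact ENNReal.sum_lt_top.2 fun j _ => (memLp_two_iff (hφg j).1).1 (hφg j)

/-- The a priori bound with $g=0$. -/
theorem memLp_optFilter_mul (H : IsAdmissible p ν η ψ φ) {δ : ℝ} (hδ : 0 < δ) {y : Rd d → ℂ}
    (hy : MemLp y p volume) : MemLp (fun t => optFilter p ν η ψ φ δ t * y t) 2 volume := by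
  have h := memLp_sub_optFilter H hδ (g := fun _ => 0) MemLp.zero' hy
    (fun j => by simp)
  have h' := h.neg
  refine h'.ae_eq (Filter.Eventually.of_forall fun t => ?_)
  simp

/-- The a priori bound with $y=0$; any positive $\delta$ would do. -/
theorem memLp_mul_of_memLp (H : IsAdmissible p ν η ψ φ) {g : Rd d → ℂ}
    (hg : MemLp g p volume) (hφg : ∀ j, MemLp (fun t => φ j t * g t) 2 volume) :
    MemLp (fun t => ψ t * g t) 2 volume := by
  simpa using memLp_sub_optFilter H one_pos hg (y := fun _ => 0) MemLp.zero' hφg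

/-- The error bound for the filter, homogeneous in the size `τ` of the derivatives. -/
theorem filter_error_le (H : IsAdmissible p ν η ψ φ) {δ τ : ℝ} (hδ : 0 < δ) (hτ : 0 < τ)
    {g y : Rd d → ℂ} (hg : AEStronglyMeasurable g volume) (hy : AEStronglyMeasurable y volume)
    (hφg : ∀ j, ENNReal.ofReal ((2 * Real.pi) ^ (-(d : ℝ))) * ∫⁻ t, ‖φ j t * g t‖ₑ ^ 2 ≤
      ENNReal.ofReal (τ ^ 2))
    (hgy : eLpNorm (g - y) p volume ≤ ENNReal.ofReal (δ * τ)) :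
    ENNReal.ofReal ((2 * Real.pi) ^ (-(d : ℝ))) *
      ∫⁻ t, ‖ψ t * g t - optFilter p ν η ψ φ δ t * y t‖ₑ ^ 2 ≤
      ENNReal.ofReal (sharpConst p ν η ψ φ * δ ^ gam d p ν η * τ) ^ 2 := by
  have hb := H.beta_pos hδ
  have hA := H.level_pos
  have hn : (0 : ℝ) < n := by exact_mod_cast H.card_pos
  have h0 := H.gam_mem.1
  have h1 := sub_pos.2 H.gam_mem.2
  have hS := sharpConst_pos H.card_pos H.two_lt H.gam_mem hA
  have hsq := sharpConst_sq H.card_pos H.two_lt H.gam_mem hA hδ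
  have hlev := level_identity H.card_pos H.two_lt H.gam_mem hA hδ
  have hpi : 0 < (2 * Real.pi) ^ (-(d : ℝ)) := Real.rpow_pos_of_pos Real.two_pi_pos _
  have hmain := lintegral_sub_optFilter_le H hδ hg hy
  set b := betaConst p ν η ψ φ δ with hbdef
  set M := b ^ (-decayExp d p ν η) * levelConst p ν η ψ φ with hMdef
  have hM : 0 < M := by positivity
  set c := ENNReal.ofReal ((2 * Real.pi) ^ (-(d : ℝ))) with hc
  calc _ ≤ c * (ENNReal.ofReal b * (∑ j, ∫⁻ t, ‖φ j t * g t‖ₑ ^ 2) +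
        ENNReal.ofReal (M ^ (2 * (1 / 2 - recip p))) * eLpNorm (g - y) p volume ^ 2) := by
        gcongr
    _ = ENNReal.ofReal b * (∑ j, c * ∫⁻ t, ‖φ j t * g t‖ₑ ^ 2) +
        c * ENNReal.ofReal (M ^ (2 * (1 / 2 - recip p))) * eLpNorm (g - y) p volume ^ 2 := by
      rw [← Finset.mul_sum]
      ring
    _ ≤ ENNReal.ofReal b * (∑ _j : Fin n, ENNReal.ofReal (τ ^ 2)) +
        c * ENNReal.ofReal (M ^ (2 * (1 / 2 - recip p))) * ENNReal.ofReal (δ * τ) ^ 2 := by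
      gcongr with j _
      exact hφg j
    _ = ENNReal.ofReal (sharpConst p ν η ψ φ * δ ^ gam d p ν η * τ) ^ 2 := by
      rw [Finset.sum_const, Finset.card_univ, Fintype.card_fin, nsmul_eq_mul,
        ← ENNReal.ofReal_natCast, ← ENNReal.ofReal_mul hn.le, ← ENNReal.ofReal_mul hb.le,
        hc, ← ENNReal.ofReal_mul hpi.le, ← ENNReal.ofReal_pow (by positivity),
        ← ENNReal.ofReal_mul (by positivity), ← ENNReal.ofReal_add (by positivity) (by positivity),
        ← ENNReal.ofReal_pow (by positivity)]
      congr 1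
      rw [mul_pow (sharpConst p ν η ψ φ * _) τ, hsq]
      have : (2 * Real.pi) ^ (-(d : ℝ)) * M ^ (2 * (1 / 2 - recip p)) * (δ * τ) ^ 2 =
          (2 * Real.pi) ^ (-(d : ℝ)) * δ ^ 2 * M ^ (2 * (1 / 2 - recip p)) * τ ^ 2 := by ring
      rw [this, hlev]
      field_simp
      ring

theorem memLp_of_normalized (H : IsAdmissible p ν η ψ φ) {u : Rd d → ℂ}
    (hu : AEStronglyMeasurable u volume)
    (huφ : ∀ j, ENNReal.ofReal ((2 * Real.pi) ^ (-(d : ℝ))) * ∫⁻ t, ‖φ j t * u t‖ₑ ^ 2 = 1) (j) :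
    MemLp (fun t => φ j t * u t) 2 volume := by
  have hpi : 0 < (2 * Real.pi) ^ (-(d : ℝ)) := Real.rpow_pos_of_pos Real.two_pi_pos _
  refine (memLp_two_iff ((H.meas_right j).mul hu)).2 (lt_top_iff_ne_top.2 fun h => ?_)
  change ∫⁻ t, ‖φ j t * u t‖ₑ ^ 2 = ∞ at h
  have := huφ j
  rw [h, ENNReal.mul_top (by simpa using hpi)] at this
  exact ENNReal.top_ne_one this

/-- The filter as a method of recovery. -/
theorem exists_filter_method (H : IsAdmissible p ν η ψ φ) {δ : ℝ} (hδ : 0 < δ) :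
    ∃ m : Method d p, ∀ y, MemLp (fun t => optFilter p ν η ψ φ δ t * y t) 2 volume ∧
      (m y : 𝓢'(Rd d, ℂ)) = tempFourierInv d (l2Dist fun t => optFilter p ν η ψ φ δ t * y t) := by
  have h : ∀ y : Lp ℂ p (volume : Measure (Rd d)), ∃ v : Lp ℂ 2 (volume : Measure (Rd d)),
      (v : 𝓢'(Rd d, ℂ)) = tempFourierInv d (l2Dist fun t => optFilter p ν η ψ φ δ t * y t) := by
    intro y
    have hmem := memLp_optFilter_mul H hδ (Lp.memLp y)
    rw [l2Dist_of_memLp hmem]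
    obtain ⟨v, hv, -⟩ := exists_lp_tempFourierInv (hmem.toLp _)
    exact ⟨v, hv⟩
  choose m hm using h
  exact ⟨m, fun y => ⟨memLp_optFilter_mul H hδ (Lp.memLp y), hm y⟩⟩

variable [Fact (1 ≤ p)]

theorem memLp_fourierFun {x : 𝓢'(Rd d, ℂ)}
    (hx : ∃ g : Lp ℂ p (volume : Measure (Rd d)), (g : 𝓢'(Rd d, ℂ)) = tempFourier d x) :
    MemLp (fourierFun p x) p volume := by
  obtain ⟨g, hg⟩ := hx
  exact (Lp.memLp g).ae_eq (fourierFun_ae_eq hg).symm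

theorem memLp_psi_mul_fourierFun (H : IsAdmissible p ν η ψ φ) {x : 𝓢'(Rd d, ℂ)}
    (hx : x ∈ spaceX p φ) : MemLp (fun ξ => ψ ξ * fourierFun p x ξ) 2 volume :=
  memLp_mul_of_memLp H (memLp_fourierFun hx.1) hx.2

theorem distNorm_multiplierOp_sq {x : 𝓢'(Rd d, ℂ)} {m : Rd d → ℂ}
    (hm : MemLp (fun t => m t * fourierFun p x t) 2 volume) :
    distNorm 2 (multiplierOp p m x) ^ 2 =
      ENNReal.ofReal ((2 * Real.pi) ^ (-(d : ℝ))) * ∫⁻ t, ‖m t * fourierFun p x t‖ₑ ^ 2 := by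
  rw [multiplierOp, distNorm_tempFourierInv_l2Dist hm]

theorem distNorm_tempFourier {x : 𝓢'(Rd d, ℂ)}
    (hx : ∃ g : Lp ℂ p (volume : Measure (Rd d)), (g : 𝓢'(Rd d, ℂ)) = tempFourier d x) :
    distNorm p (tempFourier d x) = eLpNorm (fourierFun p x) p volume := by
  obtain ⟨g, hg⟩ := hx
  rw [← hg, distNorm_coe, Lp.enorm_def, eLpNorm_congr_ae (fourierFun_ae_eq hg)]

theorem methodError_filter_le (H : IsAdmissible p ν η ψ φ) {δ : ℝ} (hδ : 0 < δ) (m : Method d p)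
    (hm : ∀ y, (m y : 𝓢'(Rd d, ℂ)) =
      tempFourierInv d (l2Dist fun t => optFilter p ν η ψ φ δ t * y t)) :
    methodError p ψ φ δ m ≤ ENNReal.ofReal (sharpConst p ν η ψ φ * δ ^ gam d p ν η) := by
  refine iSup₂_le fun x hx => iSup₂_le fun y hxy => ?_
  have hxX := hx.1
  have hopt := memLp_optFilter_mul H hδ (Lp.memLp y)
  have hψ := memLp_psi_mul_fourierFun H hxX
  have hgy : eLpNorm (fourierFun p x - ⇑y) p volume ≤ ENNReal.ofReal (δ * 1) := by
    obtain ⟨g, hg⟩ := hxX.1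
    rw [← hg, ← coe_sub, distNorm_coe, Lp.enorm_def] at hxy
    rw [mul_one]
    refine le_trans (le_of_eq (eLpNorm_congr_ae ?_)) hxy
    filter_upwards [fourierFun_ae_eq hg, Lp.coeFn_sub g y] with t h1 h2
    rw [h2, Pi.sub_apply, Pi.sub_apply, h1]
  refine enorm_le_of_sq_le_sq ?_
  rw [hm y, multiplierOp, ← map_sub, l2Dist_sub hψ hopt,
    distNorm_tempFourierInv_l2Dist (hψ.sub hopt)]
  refine (filter_error_le H hδ one_pos (memLp_fourierFun hxX.1).1 (Lp.memLp y).1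
    (fun j => ?_) hgy).trans (le_of_eq (by rw [mul_one]))
  rw [← distNorm_multiplierOp_sq (hxX.2 j)]
  simpa using pow_le_one₀ (n := 2) zero_le (hx.2 j)

/-- Only $|Fx|$ enters the constraints, so the functions $u$ and $-u$ are handled together. -/
theorem mem_classW_of_enorm_eq (H : IsAdmissible p ν η ψ φ) {x : 𝓢'(Rd d, ℂ)} {u : Rd d → ℂ}
    (hx : ∃ g : Lp ℂ p (volume : Measure (Rd d)), (g : 𝓢'(Rd d, ℂ)) = tempFourier d x)
    (hxu : ∀ᵐ t, ‖fourierFun p x t‖ₑ = ‖u t‖ₑ) (hu : AEStronglyMeasurable u volume)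
    (huφ : ∀ j, ENNReal.ofReal ((2 * Real.pi) ^ (-(d : ℝ))) * ∫⁻ t, ‖φ j t * u t‖ₑ ^ 2 = 1) :
    x ∈ classW p φ := by
  have hm := (memLp_fourierFun hx).1
  have hint : ∀ j, ∫⁻ t, ‖φ j t * fourierFun p x t‖ₑ ^ 2 = ∫⁻ t, ‖φ j t * u t‖ₑ ^ 2 := fun j => by
    refine lintegral_congr_ae ?_
    filter_upwards [hxu] with t ht
    rw [enorm_mul, enorm_mul, ht]
  have hmem : ∀ j, MemLp (fun t => φ j t * fourierFun p x t) 2 volume := fun j => by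
    refine (memLp_two_iff ((H.meas_right j).mul hm)).2 ?_
    change ∫⁻ t, ‖φ j t * fourierFun p x t‖ₑ ^ 2 < ∞
    rw [hint j]
    exact (memLp_two_iff ((H.meas_right j).mul hu)).1 (memLp_of_normalized H hu huφ j)
  refine ⟨⟨hx, hmem⟩, fun j => enorm_le_of_sq_le_sq ?_⟩
  rw [distNorm_multiplierOp_sq (hmem j), hint j, huφ j, one_pow]

theorem coe_neg (f : Lp ℂ p (volume : Measure (Rd d))) :
    ((-f : Lp ℂ p (volume : Measure (Rd d))) : 𝓢'(Rd d, ℂ)) = -(f : 𝓢'(Rd d, ℂ)) :=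
  map_neg (Lp.toTemperedDistributionCLM ℂ (volume : Measure (Rd d)) p) f

theorem l2Dist_neg {f g : Rd d → ℂ} (hf : MemLp f 2 (volume : Measure (Rd d)))
    (hfg : g =ᵐ[volume] -f) : l2Dist g = -l2Dist f := by
  have hg : MemLp g 2 volume := hf.neg.ae_eq hfg.symm
  rw [l2Dist_of_memLp hf, l2Dist_of_memLp hg, ← coe_neg, ← MemLp.toLp_neg]
  congr 1
  exact (MemLp.toLp_eq_toLp_iff hg hf.neg).2 hfg

/-- An element of the class `W` with data of size at most `δ` and the largest possible `‖Λx‖`. -/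
theorem exists_extremal_distribution (H : IsAdmissible p ν η ψ φ) {δ : ℝ} (hδ : 0 < δ) :
    ∃ x ∈ classW p φ, -x ∈ classW p φ ∧ distNorm p (tempFourier d x) ≤ ENNReal.ofReal δ ∧
      distNorm p (tempFourier d (-x)) ≤ ENNReal.ofReal δ ∧
      multiplierOp p ψ (-x) = -multiplierOp p ψ x ∧
      distNorm 2 (multiplierOp p ψ x) =
        ENNReal.ofReal (sharpConst p ν η ψ φ * δ ^ gam d p ν η) := by
  obtain ⟨u, hum, hup, huφ, huψ⟩ := exists_extremal H hδ
  have hu : MemLp u p volume := ⟨hum, hup.trans_lt ENNReal.ofReal_lt_top⟩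
  set x : 𝓢'(Rd d, ℂ) := tempFourierInv d (hu.toLp u : Lp ℂ p (volume : Measure (Rd d))) with hxdef
  have hg : ((hu.toLp u : Lp ℂ p (volume : Measure (Rd d))) : 𝓢'(Rd d, ℂ)) = tempFourier d x := by
    rw [hxdef, tempFourier_tempFourierInv]
  have hg' : ((-hu.toLp u : Lp ℂ p (volume : Measure (Rd d))) : 𝓢'(Rd d, ℂ)) =
      tempFourier d (-x) := by
    rw [coe_neg, hg, map_neg]
  have hfx : fourierFun p x =ᵐ[volume] u := (fourierFun_ae_eq hg).trans hu.coeFn_toLp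
  have hfx' : fourierFun p (-x) =ᵐ[volume] -u := by
    filter_upwards [fourierFun_ae_eq hg', Lp.coeFn_neg (hu.toLp u), hu.coeFn_toLp] with t h1 h2 h3
    rw [h1, h2, Pi.neg_apply, h3, Pi.neg_apply]
  have hxW : x ∈ classW p φ := mem_classW_of_enorm_eq H ⟨_, hg⟩
    (hfx.mono fun t ht => by rw [ht]) hum huφ
  have hxW' : -x ∈ classW p φ := mem_classW_of_enorm_eq H ⟨_, hg'⟩
    (hfx'.mono fun t ht => by rw [ht, Pi.neg_apply, enorm_neg]) hum huφ
  have hψ := memLp_psi_mul_fourierFun H hxW.1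
  have hnorm : ‖hu.toLp u‖ₑ ≤ ENNReal.ofReal δ := by
    rwa [Lp.enorm_def, eLpNorm_congr_ae hu.coeFn_toLp]
  refine ⟨x, hxW, hxW', ?_, ?_, ?_, ?_⟩
  · rwa [← hg, distNorm_coe]
  · rwa [← hg', distNorm_coe, enorm_neg]
  · have hae : (fun ξ => ψ ξ * fourierFun p (-x) ξ) =ᵐ[volume]
        -fun ξ => ψ ξ * fourierFun p x ξ := by
      filter_upwards [hfx, hfx'] with t h1 h2
      rw [h2, Pi.neg_apply, Pi.neg_apply, h1, mul_neg]
    rw [multiplierOp, multiplierOp, l2Dist_neg hψ hae, map_neg]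
  · have hS := sharpConst_pos H.card_pos H.two_lt H.gam_mem H.level_pos
    have hsq : distNorm 2 (multiplierOp p ψ x) ^ 2 =
        ENNReal.ofReal (sharpConst p ν η ψ φ * δ ^ gam d p ν η) ^ 2 := by
      rw [distNorm_multiplierOp_sq hψ, ← ENNReal.ofReal_pow (by positivity), ← huψ]
      congr 1
      refine lintegral_congr_ae ?_
      filter_upwards [hfx] with t ht
      rw [ht]
    exact le_antisymm (enorm_le_of_sq_le_sq hsq.le) (enorm_le_of_sq_le_sq hsq.ge)

theorem le_methodError (H : IsAdmissible p ν η ψ φ) {δ : ℝ} (hδ : 0 < δ) (m : Method d p) :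
    ENNReal.ofReal (sharpConst p ν η ψ φ * δ ^ gam d p ν η) ≤ methodError p ψ φ δ m := by
  obtain ⟨x, hxW, hxW', hd, hd', hneg, hval⟩ := exists_extremal_distribution H hδ
  have hψ := memLp_psi_mul_fourierFun H hxW.1
  obtain ⟨v, hv, -⟩ := exists_lp_tempFourierInv (hψ.toLp _)
  have hΛ : multiplierOp p ψ x = (v : 𝓢'(Rd d, ℂ)) := by
    rw [hv, multiplierOp, l2Dist_of_memLp hψ]
  have h0 : ((0 : Lp ℂ p (volume : Measure (Rd d))) : 𝓢'(Rd d, ℂ)) = 0 :=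
    map_zero (Lp.toTemperedDistributionCLM ℂ (volume : Measure (Rd d)) p)
  have hle : ∀ z ∈ classW p φ, distNorm p (tempFourier d z) ≤ ENNReal.ofReal δ →
      distNorm 2 (multiplierOp p ψ z - (m 0 : 𝓢'(Rd d, ℂ))) ≤ methodError p ψ φ δ m :=
    fun z hz hzd => le_iSup₂_of_le z hz (le_iSup₂_of_le 0 (by rwa [h0, sub_zero]) le_rfl)
  have h1 := hle x hxW hd
  have h2 := hle (-x) hxW' hd'
  rw [hneg, hΛ, ← coe_neg, ← coe_sub, distNorm_coe] at h2
  rw [hΛ, ← coe_sub, distNorm_coe] at h1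
  rw [← hval, hΛ, distNorm_coe]
  by_contra hlt
  rw [not_le] at hlt
  -- A method sees the datum $0$ for both $x$ and $-x$ and answers with the same $m(0)$, which
  -- cannot be closer than $\|\Lambda x\|$ to both $\Lambda x$ and $-\Lambda x$.
  have h3 : ‖v‖ₑ + ‖v‖ₑ ≤ ‖v - m 0‖ₑ + ‖-v - m 0‖ₑ := by
    have e : ‖v‖ₑ + ‖v‖ₑ = ‖v + v‖ₑ := by
      rw [← ofReal_norm, ← ofReal_norm, ← ENNReal.ofReal_add (norm_nonneg _) (norm_nonneg _),
        ← two_smul ℝ v, norm_smul, Real.norm_two, two_mul]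
    rw [e]
    have : v + v = (v - m 0) - (-v - m 0) := by abel
    rw [this]
    exact enorm_sub_le
  exact absurd (h3.trans (add_le_add h1 h2)) (not_le.2 (ENNReal.add_lt_add hlt hlt))

theorem distNorm_multiplierOp_le (H : IsAdmissible p ν η ψ φ) {x : 𝓢'(Rd d, ℂ)}
    (hx : x ∈ spaceX p φ) :
    distNorm 2 (multiplierOp p ψ x) ≤ ENNReal.ofReal (sharpConst p ν η ψ φ) *
      distNorm p (tempFourier d x) ^ gam d p ν η *
        (⨆ j, distNorm 2 (multiplierOp p (φ j) x)) ^ (1 - gam d p ν η) := by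
  have h0 := H.gam_mem.1
  have h1 := sub_pos.2 H.gam_mem.2
  have hS := sharpConst_pos H.card_pos H.two_lt H.gam_mem H.level_pos
  have hpi : 0 < (2 * Real.pi) ^ (-(d : ℝ)) := Real.rpow_pos_of_pos Real.two_pi_pos _
  have hψ := memLp_psi_mul_fourierFun H hx
  have hf := memLp_fourierFun hx.1
  set g := fourierFun p x with hgdef
  have hzero : (∀ᵐ t, g t = 0) → distNorm 2 (multiplierOp p ψ x) = 0 := fun h => by
    have hz : distNorm 2 (multiplierOp p ψ x) ^ 2 = 0 := by
      rw [distNorm_multiplierOp_sq hψ, lintegral_congr_ae (g := fun _ => 0), lintegral_zero,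
        mul_zero]
      filter_upwards [h] with t ht
      rw [← hgdef, ht]; simp
    exact pow_eq_zero_iff two_ne_zero |>.1 hz
  set τ := ⨆ j, distNorm 2 (multiplierOp p (φ j) x) with hτ
  have hD : distNorm p (tempFourier d x) = eLpNorm g p volume := distNorm_tempFourier hx.1
  rw [hD]
  have hDj := fun j => distNorm_multiplierOp_sq (hx.2 j)
  have hτtop : τ ≠ ∞ := by
    have : ∀ j, distNorm 2 (multiplierOp p (φ j) x) < ∞ := fun j => by
      have : distNorm 2 (multiplierOp p (φ j) x) ^ 2 < ∞ := by
        rw [hDj j]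
        exact ENNReal.mul_lt_top ENNReal.ofReal_lt_top ((memLp_two_iff (hx.2 j).1).1 (hx.2 j))
      simpa [ENNReal.pow_lt_top_iff] using this
    have := (Finset.sup_lt_iff (s := Finset.univ) (a := ∞)
      (f := fun j => distNorm 2 (multiplierOp p (φ j) x)) ENNReal.zero_lt_top).2 fun j _ => this j
    rw [Finset.sup_univ_eq_iSup] at this
    exact this.ne
  have hDtop : eLpNorm g p volume ≠ ∞ := hf.2.ne
  have hp0 : p ≠ 0 := by
    rintro rfl
    exact absurd H.two_lt (by simp)
  by_cases hD0 : eLpNorm g p volume = 0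
  · rw [hzero ((eLpNorm_eq_zero_iff hf.1 hp0).1 hD0)]
    exact zero_le
  -- If all $D_jx$ vanish then $Fx=0$, because the $\varphi_j$ have almost no common zeros.
  by_cases hτ0 : τ = 0
  · rw [hzero]
    · exact zero_le
    have hj : ∀ j, ∀ᵐ t, φ j t * g t = 0 := fun j => by
      have h2 : distNorm 2 (multiplierOp p (φ j) x) = 0 :=
        le_antisymm ((le_iSup (fun j => distNorm 2 (multiplierOp p (φ j) x)) j).trans hτ0.le) zero_le
      have h3 := hDj j
      rw [h2, zero_pow two_ne_zero, eq_comm, mul_eq_zero] at h3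
      have h4 := h3.resolve_left (by simpa using hpi)
      rw [lintegral_eq_zero_iff' ((hx.2 j).1.enorm.pow_const 2)] at h4
      filter_upwards [h4] with t ht
      simpa using ht
    filter_upwards [ae_all_iff.2 hj, H.ne_zero_right] with t h2 h3
    by_contra hg0
    exact h3 (Finset.sum_eq_zero fun j _ => by
      rw [(mul_eq_zero.1 (h2 j)).resolve_right hg0, norm_zero])
  have hDr : 0 < (eLpNorm g p volume).toReal := ENNReal.toReal_pos hD0 hDtop
  have hτr : 0 < τ.toReal := ENNReal.toReal_pos hτ0 hτtop
  -- With $y=0$ the filter drops out. This $\delta$ makes $\delta\tau=\|Fx\|_p$, and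
  -- $\delta^\gamma\tau=\|Fx\|_p^\gamma\tau^{1-\gamma}$.
  have key := filter_error_le H (δ := (eLpNorm g p volume).toReal / τ.toReal) (τ := τ.toReal)
    (by positivity) hτr hf.1 (y := fun _ => 0) aestronglyMeasurable_const (fun j => ?_) ?_
  · simp only [mul_zero, sub_zero] at key
    rw [← distNorm_multiplierOp_sq hψ] at key
    refine (enorm_le_of_sq_le_sq key).trans (le_of_eq ?_)
    rw [Real.div_rpow hDr.le hτr.le]
    have e : sharpConst p ν η ψ φ * ((eLpNorm g p volume).toReal ^ gam d p ν η /
        τ.toReal ^ gam d p ν η) * τ.toReal = sharpConst p ν η ψ φ *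
        (eLpNorm g p volume).toReal ^ gam d p ν η * τ.toReal ^ (1 - gam d p ν η) := by
      rw [Real.rpow_sub hτr, Real.rpow_one]
      field_simp
    rw [e, ENNReal.ofReal_mul (by positivity), ENNReal.ofReal_mul hS.le,
      ← ENNReal.ofReal_rpow_of_pos hDr, ← ENNReal.ofReal_rpow_of_pos hτr,
      ENNReal.ofReal_toReal hDtop, ENNReal.ofReal_toReal hτtop]
  · rw [← hDj j, ENNReal.ofReal_pow hτr.le, ENNReal.ofReal_toReal hτtop]
    gcongr
    exact le_iSup (fun j => distNorm 2 (multiplierOp p (φ j) x)) j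
  · rw [div_mul_cancel₀ _ hτr.ne', ENNReal.ofReal_toReal hDtop]
    refine le_of_eq (congrArg (fun f => eLpNorm f p volume) ?_)
    funext t
    simp

theorem isLeast_sharpConst (H : IsAdmissible p ν η ψ φ) :
    IsLeast {C : ℝ≥0∞ | ∀ x ∈ spaceX p φ,
        distNorm 2 (multiplierOp p ψ x) ≤
          C * distNorm p (tempFourier d x) ^ gam d p ν η *
            (⨆ j, distNorm 2 (multiplierOp p (φ j) x)) ^ (1 - gam d p ν η)}
      (ENNReal.ofReal (sharpConst p ν η ψ φ)) := by
  refine ⟨fun x hx => distNorm_multiplierOp_le H hx, fun C hC => ?_⟩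
  -- At $\delta=1$ both factors on the right are at most $1$ and $\|\Lambda x\|$ is the constant
  -- itself.
  obtain ⟨x, hxW, -, hd, -, -, hval⟩ := exists_extremal_distribution H one_pos
  have h := hC x hxW.1
  rw [hval, Real.one_rpow, mul_one] at h
  refine h.trans ?_
  rw [ENNReal.ofReal_one] at hd
  have h1 : distNorm p (tempFourier d x) ^ gam d p ν η ≤ 1 :=
    ENNReal.rpow_le_one hd H.gam_mem.1.le
  have h2 : (⨆ j, distNorm 2 (multiplierOp p (φ j) x)) ^ (1 - gam d p ν η) ≤ 1 :=
    ENNReal.rpow_le_one (iSup_le hxW.2) (sub_pos.2 H.gam_mem.2).le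
  calc _ ≤ C * 1 * 1 := by gcongr
    _ = C := by simp

end recovery

end NoisyFourier

end

open NoisyFourier
theorem theorem6 (d n : ℕ) (hd : 1 ≤ d) (p : ℝ≥0∞) [Fact (1 ≤ p)] (hp : 2 < p) (ν η : ℝ)
    (ψ : Rd d → ℂ) (φ : Fin n → Rd d → ℂ)
    (hψm : AEStronglyMeasurable ψ volume) (hφm : ∀ j, AEStronglyMeasurable (φ j) volume)
    (hψhom : IsAbsHomogeneous ψ η) (hφhom : ∀ j, IsAbsHomogeneous (φ j) ν)
    (hψ0 : ∀ᵐ t : Rd d, ψ t ≠ 0) (hφ0 : ∀ᵐ t : Rd d, ∑ j, ‖φ j t‖ ≠ 0)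
    (hγ : gam d p ν η ∈ Ioo (0 : ℝ) 1)
    (hI : intI p ν η ψ φ < ∞) (hI' : ∀ i j, intI' p ν η ψ φ i = intI' p ν η ψ φ j)
    (δ : ℝ) (hδ : 0 < δ) :
    -- `Λ` maps `X_p` to `L_2`
    (∀ x ∈ spaceX p φ, MemLp (fun ξ => ψ ξ * fourierFun p x ξ) 2 (volume : Measure (Rd d))) ∧
    -- the error of optimal recovery
    optimalError p ψ φ δ = ENNReal.ofReal (sharpConst p ν η ψ φ * δ ^ gam d p ν η) ∧
    -- the optimal method
    (∃ m : Method d p,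
      (∀ y, MemLp (fun t => optFilter p ν η ψ φ δ t * y t) 2 (volume : Measure (Rd d)) ∧
        (m y : 𝓢'(Rd d, ℂ)) =
          tempFourierInv d (l2Dist fun t => optFilter p ν η ψ φ δ t * y t)) ∧
      methodError p ψ φ δ m = optimalError p ψ φ δ) ∧
    -- the sharp inequality
    IsLeast {C : ℝ≥0∞ | ∀ x ∈ spaceX p φ,
        distNorm 2 (multiplierOp p ψ x) ≤
          C * distNorm p (tempFourier d x) ^ gam d p ν η *
            (⨆ j, distNorm 2 (multiplierOp p (φ j) x)) ^ (1 - gam d p ν η)}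
      (ENNReal.ofReal (sharpConst p ν η ψ φ)) := by
  have H : IsAdmissible p ν η ψ φ := ⟨hd, hp, hψm, hφm, hψhom, hφhom, hψ0, hφ0, hγ, hI, hI'⟩
  obtain ⟨m, hm⟩ := exists_filter_method H hδ
  have hme := methodError_filter_le H hδ m fun y => (hm y).2
  have hopt : optimalError p ψ φ δ =
      ENNReal.ofReal (sharpConst p ν η ψ φ * δ ^ gam d p ν η) :=
    le_antisymm ((iInf_le _ m).trans hme) (le_iInf fun m => le_methodError H hδ m)
  refine ⟨fun x hx => memLp_psi_mul_fourierFun H hx, hopt, ⟨m, hm, ?_⟩, isLeast_sharpConst H⟩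
  exact le_antisymm (hopt ▸ hme) (iInf_le _ m)
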